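/- Conventions. A $(\mathbb Z,\mathbb R)$-polyhedron in $\mathbb R^n$ is a finite intersection of half-spaces $\{x : m_1x_1+\dots+m_nx_n+c\ge 0\}$ with $m_i\in\mathbb Z$, $c\in\mathbb R$; its faces are $\emptyset$, itself, and its intersections with boundaries of half-spaces containing it. A $(\mathbb Z,\mathbb R)$-polyhedral complex is a set of such polyhedra that contains all faces of its members and in which any two members intersect in a common face. For a polyhedron $\sigma$, $L_\sigma$ is the linear space of directions of its affine span and $N_\sigma = L_\sigma\cap\mathbb Z^n$. A tropical variety $C$ of pure dimension $d$ in an open set $U\subseteq\mathbb R^n$ is given by a $(\mathbb Z,\mathbb R)$-polyhedral complex $\mathscr C$, locally finite in $U$, each of whose members meeting $U$ is contained in a $d$-dimensional member, together with constant weights $m_\sigma>0$ on the $d$-dimensional members meeting $U$, such that for each $(d-1)$-dimensional $\tau\in\mathscr C$ meeting $U$ the balancing condition $\sum_{\sigma\supset\tau} m_\sigma w_{\sigma,\tau}\in L_\tau$ holds; here $\sigma$ runs over the $d$-dimensional members containing $\tau$ and $w_{\sigma,\tau}\in N_\sigma$ generates $N_\sigma/N_\tau$ and points from $\tau$ into $\sigma$.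 We also write $C=U\cap\bigcup_{\sigma\in\mathscr C}\sigma$. A refinement of $\mathscr C$ (with the induced weights) defines the same $C$. A function $f\colon C\to\mathbb R$ is piecewise smooth if it is continuous and, for some such refinement, its restriction to each cell, within $U$, extends to a smooth function on a neighbourhood. Lagerberg forms of bidegree $(p,q)$ are sections of $C^\infty\otimes\Lambda^p(\mathbb R^n)^*\otimes\Lambda^q(\mathbb R^n)^*$, with the differentials $d'$, $d''$ of bidegrees $(1,0)$ and $(0,1)$. A $(d,d)$-form with compact support in $U$ is integrated over $C$ by $\int_C\beta=\sum_\sigma m_\sigma\int_{\sigma\cap U}\beta$, where, in affine coordinates $t$ on $\sigma$ given by a basis of $N_\sigma$, $\int g\,d't_1\wedge d''t_1\wedge\dots\wedge d't_d\wedge d''t_d=\int g\,dt$. A $(p,p)$-form is positive on $C$ if at each point of each cell its restriction to the cell is a finite sum of $(-1)^{p(p-1)/2}\alpha\wedge J\alpha$ with $\alpha$ of bidegree $(p,0)$, where $J$ exchanges $d'$ and $d''$. The function $f$ is weakly tropically psh if the Lagerberg current $d'd''[f]$ on $C$ is positive, i.e. $\int_C f\,d'd''\eta\ge 0$ for each smooth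 $(d-1,d-1)$-form $\eta$ with compact support in $U$ that is positive on $C$ (an empty condition if $d=0$). Proposition (tropical maximum principle). Let $C$ be a tropical variety of pure dimension $d$ in an open subset $U$ of $\mathbb R^n$, and let $f\colon C\to\mathbb R$ be a piecewise smooth function that is weakly tropically psh. If $f$ has a local maximum at $\omega\in C$, then $f$ is constant in a neighbourhood of $\omega$ in $C$. -/

import Mathlib

open Set Filter Topology MeasureTheory
open scoped ContDiff

noncomputable section

namespace Tropical

/-! ### Polyhedral geometry -/

/-- A `(ℤ, ℝ)`-polyhedron: a finite intersection of half-spaces `{x | 0 ≤ m · x + c}` with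
integral slopes `m` and real constants `c`. -/
def IsPolyhedron {n : ℕ} (Δ : Set (Fin n → ℝ)) : Prop :=
  ∃ s : Finset ((Fin n → ℤ) × ℝ), Δ = {x | ∀ a ∈ s, 0 ≤ ∑ i, (a.1 i : ℝ) * x i + a.2}

/-- A `(ℤ, ℝ)`-polyhedral complex in `ℝⁿ`. The faces of a polyhedron are its exposed subsets:
the empty set, the polyhedron itself, and its intersections with the boundaries of half-spaces
containing it. -/
structure PolyhedralComplex (n : ℕ) where
  cells : Set (Set (Fin n → ℝ))
  isPolyhedron : ∀ σ ∈ cells, IsPolyhedron σ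
  face_mem : ∀ σ ∈ cells, ∀ τ, IsExposed ℝ σ τ → τ ∈ cells
  inter_face : ∀ σ ∈ cells, ∀ τ ∈ cells, IsExposed ℝ σ (σ ∩ τ)

namespace PolyhedralComplex

variable {n : ℕ}

/-- The `k`-dimensional cells which meet `U`. -/
def facesOfDim (K : PolyhedralComplex n) (U : Set (Fin n → ℝ)) (k : ℕ) :
    Set (Set (Fin n → ℝ)) :=
  {σ ∈ K.cells | (σ ∩ U).Nonempty ∧ Module.finrank ℝ (vectorSpan ℝ σ) = k}

/-- The part in `U` of the union of all cells. -/
def supportIn (K : PolyhedralComplex n) (U : Set (Fin n → ℝ)) : Set (Fin n → ℝ) :=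
  (⋃ σ ∈ K.cells, σ) ∩ U

/-- Every point of `U` has a neighbourhood that meets only finitely many cells. -/
def LocallyFiniteIn (K : PolyhedralComplex n) (U : Set (Fin n → ℝ)) : Prop :=
  ∀ x ∈ U, ∃ V ∈ 𝓝 x, {σ ∈ K.cells | (σ ∩ V).Nonempty}.Finite

end PolyhedralComplex

/-- The lattice `N_σ` of integral vectors parallel to `σ`. -/
def lattice {n : ℕ} (σ : Set (Fin n → ℝ)) : Submodule ℤ (Fin n → ℝ) :=
  (vectorSpan ℝ σ).restrictScalars ℤ ⊓ Submodule.span ℤ (Set.range (Pi.basisFun ℝ (Fin n)))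

/-- `w` is a lattice normal vector of `σ` along its facet `τ`: it generates `N_σ` modulo `N_τ`
and points from `τ` into `σ`. -/
def IsNormalVector {n : ℕ} (τ σ : Set (Fin n → ℝ)) (w : Fin n → ℝ) : Prop :=
  lattice σ = lattice τ ⊔ Submodule.span ℤ {w} ∧ ∃ x ∈ τ, ∃ ε > (0 : ℝ), x + ε • w ∈ σ

/-- A tropical variety of pure dimension `d` in `U`: a polyhedral complex that is locally finite
in `U` and of pure dimension `d` there, with positive weights on the `d`-dimensional cells, which
is balanced along each cell of dimension `d - 1`. Only what lies in `U` matters. -/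
structure TropicalVariety {n : ℕ} (U : Set (Fin n → ℝ)) (d : ℕ) extends PolyhedralComplex n where
  locallyFinite : toPolyhedralComplex.LocallyFiniteIn U
  pure_dim : ∀ σ ∈ cells, (σ ∩ U).Nonempty → ∃ σ' ∈ toPolyhedralComplex.facesOfDim U d, σ ⊆ σ'
  weight : Set (Fin n → ℝ) → ℝ
  weight_pos : ∀ σ ∈ toPolyhedralComplex.facesOfDim U d, 0 < weight σ
  balanced : ∀ k, k + 1 = d → ∀ τ ∈ toPolyhedralComplex.facesOfDim U k,
    ∃ w : Set (Fin n → ℝ) → (Fin n → ℝ),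
      (∀ σ ∈ toPolyhedralComplex.facesOfDim U d, τ ⊆ σ → IsNormalVector τ σ (w σ)) ∧
      ∑ᶠ σ ∈ {σ ∈ toPolyhedralComplex.facesOfDim U d | τ ⊆ σ}, weight σ • w σ ∈ vectorSpan ℝ τ

/-! ### Lagerberg forms -/

/-- Lagerberg forms of bidegree `(p, q)` on `ℝⁿ`, i.e. functions with values in
`Λᵖ(ℝⁿ)* ⊗ Λ^q(ℝⁿ)*`: the first `p` vectors are the arguments of the `d'`-part, the last `q`
vectors are the arguments of the `d''`-part. -/
abbrev LagerbergForm (n p q : ℕ) : Type :=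
  (Fin n → ℝ) → (Fin n → ℝ) [⋀^Fin p]→L[ℝ] ((Fin n → ℝ) [⋀^Fin q]→L[ℝ] ℝ)

/-- `d' (f d'x_I ∧ d''x_J) = ∑ᵢ ∂ᵢf d'xᵢ ∧ d'x_I ∧ d''x_J`. -/
def dPrime {n p q : ℕ} (β : LagerbergForm n p q) : LagerbergForm n (p + 1) q :=
  extDeriv β

/-- `d'' (f d'x_I ∧ d''x_J) = ∑ᵢ ∂ᵢf d''xᵢ ∧ d'x_I ∧ d''x_J`
`= (-1)ᵖ ∑ᵢ ∂ᵢf d'x_I ∧ d''xᵢ ∧ d''x_J`. -/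
def dDoublePrime {n p q : ℕ} (β : LagerbergForm n p q) : LagerbergForm n p (q + 1) :=
  fun x => (-1 : ℝ) ^ p •
    (ContinuousAlternatingMap.alternatizeUncurryFinCLM ℝ
      (Fin n → ℝ) ℝ).compContinuousAlternatingMap (fderiv ℝ β x).flipAlternating

/-- Smooth forms with compact support in `U`. Each compactly supported smooth form on a polyhedral
subset of `U` that is closed in `U` is the restriction of such a form. -/
structure IsTestForm {n p q : ℕ} (U : Set (Fin n → ℝ)) (η : LagerbergForm n p q) : Prop where
  smooth : ContDiff ℝ ∞ η
  hasCompactSupport : HasCompactSupport η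
  tsupport_subset : tsupport η ⊆ U

/-- The restriction of the `(p, p)`-form `η` to `σ` is positive at the point `x`: on vectors
parallel to `σ` it is a finite sum of forms `(-1)^(p(p-1)/2) α ∧ Jα`, where `α` has bidegree
`(p, 0)`. -/
def IsPositiveAt {n p : ℕ} (η : LagerbergForm n p p) (σ : Set (Fin n → ℝ)) (x : Fin n → ℝ) :
    Prop :=
  ∃ (m : ℕ) (α : Fin m → (Fin n → ℝ) [⋀^Fin p]→L[ℝ] ℝ),
    ∀ v w : Fin p → (Fin n → ℝ), (∀ i, v i ∈ vectorSpan ℝ σ) → (∀ i, w i ∈ vectorSpan ℝ σ) →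
      η x v w = (-1 : ℝ) ^ (p * (p - 1) / 2) * ∑ s, α s v * α s w

/-- The affine parametrization with base point `x` and directions `b`. -/
def param {n d : ℕ} (x : Fin n → ℝ) (b : Fin d → (Fin n → ℝ)) (t : Fin d → ℝ) : Fin n → ℝ :=
  x + ∑ i, t i • b i

/-- `b` is a basis of the lattice `N_σ`, and `x` is a point of `σ`. -/
def IsLatticeFrame {n d : ℕ} (σ : Set (Fin n → ℝ)) (x : Fin n → ℝ) (b : Fin d → (Fin n → ℝ)) :
    Prop :=
  x ∈ σ ∧ LinearIndependent ℝ b ∧ Submodule.span ℤ (Set.range b) = lattice σ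

open Classical in
/-- The integral of a `(d, d)`-form over the part in `U` of a `d`-dimensional polyhedron `σ`: in
affine coordinates `t` given by a basis of `N_σ`, the integral of
`g d't₁ ∧ d''t₁ ∧ ⋯ ∧ d't_d ∧ d''t_d` is the Lebesgue integral of `g`. -/
def faceIntegral {n d : ℕ} (U σ : Set (Fin n → ℝ)) (β : LagerbergForm n d d) : ℝ :=
  if h : ∃ y : (Fin n → ℝ) × (Fin d → (Fin n → ℝ)), IsLatticeFrame σ y.1 y.2 then
    ∫ t in {t : Fin d → ℝ | param h.choose.1 h.choose.2 t ∈ σ ∩ U},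
      (-1 : ℝ) ^ (d * (d - 1) / 2) *
        β (param h.choose.1 h.choose.2 t) h.choose.2 h.choose.2
  else 0

namespace TropicalVariety

variable {n d : ℕ} {U : Set (Fin n → ℝ)}

/-- The underlying set of the tropical variety, a subset of `U`. -/
def support (C : TropicalVariety U d) : Set (Fin n → ℝ) :=
  C.toPolyhedralComplex.supportIn U

/-- Integration of compactly supported `(d, d)`-forms over the weighted complex. -/
def integral (C : TropicalVariety U d) (β : LagerbergForm n d d) : ℝ :=
  ∑ᶠ σ ∈ C.toPolyhedralComplex.facesOfDim U d, C.weight σ * faceIntegral U σ β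

/-- A `(p, p)`-form is positive on the tropical variety if its restriction to each cell is. -/
def IsPositiveForm (C : TropicalVariety U d) {p : ℕ} (η : LagerbergForm n p p) : Prop :=
  ∀ σ ∈ C.cells, ∀ x ∈ σ ∩ U, IsPositiveAt η σ x

/-- A current, as a functional on `(p, p)`-forms, is positive if it is nonnegative on each positive
compactly supported smooth form. -/
def IsPositiveCurrent (C : TropicalVariety U d) {p : ℕ} (S : LagerbergForm n p p → ℝ) : Prop :=
  ∀ η : LagerbergForm n p p, IsTestForm U η → C.IsPositiveForm η → 0 ≤ S η

/-- The current `[f]`, i.e. `β ↦ ∫_C f β`. -/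
def currentOf (C : TropicalVariety U d) (f : (Fin n → ℝ) → ℝ) (β : LagerbergForm n d d) : ℝ :=
  C.integral (fun x => f x • β x)

/-- `C'` is a refinement of `C`: it has the same support in `U`, each of its cells lies, within
`U`, in a cell of `C`, and its weights are induced by those of `C`. -/
structure IsRefinement (C' C : TropicalVariety U d) : Prop where
  support_eq : C'.support = C.support
  cell_subset : ∀ σ' ∈ C'.cells, (σ' ∩ U).Nonempty → ∃ σ ∈ C.cells, σ' ∩ U ⊆ σ
  weight_eq : ∀ σ' ∈ C'.toPolyhedralComplex.facesOfDim U d,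
    ∀ σ ∈ C.toPolyhedralComplex.facesOfDim U d, σ' ∩ U ⊆ σ → C'.weight σ' = C.weight σ

/-- `f` is smooth on each cell, i.e. extends to a smooth function around the part of the cell
in `U`. -/
def SmoothOnCells (C : TropicalVariety U d) (f : (Fin n → ℝ) → ℝ) : Prop :=
  ∀ σ ∈ C.cells, ∃ (V : Set (Fin n → ℝ)) (g : (Fin n → ℝ) → ℝ),
    IsOpen V ∧ σ ∩ U ⊆ V ∧ ContDiffOn ℝ ∞ g V ∧ EqOn f g (σ ∩ U)

/-- Piecewise smooth functions on the support: continuous, and smooth on each cell of some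
refinement. Values of `f` off the support play no role. -/
def IsPiecewiseSmooth (C : TropicalVariety U d) (f : (Fin n → ℝ) → ℝ) : Prop :=
  ContinuousOn f C.support ∧ ∃ C' : TropicalVariety U d, C'.IsRefinement C ∧ C'.SmoothOnCells f

end TropicalVariety

/-- `d'd''S` for a current `S`, i.e. `η ↦ S (d'd''η)`. -/
def ddcCurrent {n p : ℕ} (S : LagerbergForm n (p + 1) (p + 1) → ℝ) (η : LagerbergForm n p p) : ℝ :=
  S (dPrime (dDoublePrime η))

/-- `f` is weakly tropically psh on `C`: the current `d'd''[f]` is positive. In dimension `0` this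
current vanishes, since there are no forms of bidegree `(-1, -1)`. -/
def TropicalVariety.IsWeaklyPsh {n : ℕ} {U : Set (Fin n → ℝ)} :
    {d : ℕ} → TropicalVariety U d → ((Fin n → ℝ) → ℝ) → Prop
  | 0, _, _ => True
  | _ + 1, C, f => C.IsPositiveCurrent (ddcCurrent (C.currentOf f))

end Tropical

end

noncomputable section

namespace Tropical

/-! ### Polyhedra -/

/-! This is the mean value inequality for subharmonic functions, applied simultaneously on all cells
through `x₀`. Near `x₀` these cells are cones with apex `x₀` (`exists_radius`). Test forms are taken
to be `η = Φ(s) κ` with `s = |x - x₀|²`, `Φ ≥ 0`, and `κ` the constant form `gramForm`, which is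
positive on every cell. On a `d`-dimensional cell through `x₀`, `d'd''η` is a positive constant
times the Euclidean radial Laplacian `4 s Φ'' + 2 d Φ'` (`ddc_radial_smul_gramForm_apply`). The
profile is the same on every cell, so one choice of `Φ` serves all of them.

For a bump density `χ ≥ 0` and `0 < ε ≤ 1`, solving an ODE gives such a `Φ` whose Laplacian is `χ(s)
- ε⁻ᵈ χ(s / ε²)` (`exists_radialProfile`). Rescaling the cone, the integral of `f d'd''η` over a
cell becomes a positive constant times `∫ f χ - ∫ f(x₀ + ε y) χ`, which tends to `∫ (f - f(x₀)) χ`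
as `ε → 0` (`exists_tendsto_faceIntegral`). Each limit is `≤ 0` because `x₀` is a maximum. The
weighted sum is `≥ 0` for every `ε` by the psh condition, hence also in the limit. Since the weights
are positive, every limit vanishes, and by continuity `f = f(x₀)` wherever `χ > 0`. Centring the
bump at `|x - x₀|²` for a given nearby `x` yields `f(x) = f(x₀)`. In dimension `0` the support is
discrete. -/

theorem IsPolyhedron.isClosed {n : ℕ} {σ : Set (Fin n → ℝ)} (hσ : IsPolyhedron σ) :
    IsClosed σ := by
  obtain ⟨s, rfl⟩ := hσ
  have : {x : Fin n → ℝ | ∀ a ∈ s, 0 ≤ ∑ i, (a.1 i : ℝ) * x i + a.2} =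
      ⋂ a ∈ s, {x | 0 ≤ ∑ i, (a.1 i : ℝ) * x i + a.2} := by
    ext; simp
  rw [this]
  refine isClosed_biInter fun a _ => isClosed_le continuous_const ?_
  fun_prop

theorem sum_mul_add_smul {n : ℕ} (m : Fin n → ℤ) (x v : Fin n → ℝ) (r : ℝ) :
    ∑ i, (m i : ℝ) * (x + r • v) i = ∑ i, (m i : ℝ) * x i + r * ∑ i, (m i : ℝ) * v i := by
  rw [Finset.mul_sum, ← Finset.sum_add_distrib]
  refine Finset.sum_congr rfl fun i _ => ?_
  simp only [Pi.add_apply, Pi.smul_apply, smul_eq_mul]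
  ring

theorem IsPolyhedron.convex {n : ℕ} {σ : Set (Fin n → ℝ)} (hσ : IsPolyhedron σ) :
    Convex ℝ σ := by
  obtain ⟨s, rfl⟩ := hσ
  intro x hx y hy a b ha hb hab c hc
  have h1 := hx c hc
  have h2 := hy c hc
  have : ∑ i, (c.1 i : ℝ) * (a • x + b • y) i + c.2 =
      a * (∑ i, (c.1 i : ℝ) * x i + c.2) + b * (∑ i, (c.1 i : ℝ) * y i + c.2) := by
    have e : ∑ i, (c.1 i : ℝ) * (a • x + b • y) i =
        a * ∑ i, (c.1 i : ℝ) * x i + b * ∑ i, (c.1 i : ℝ) * y i := by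
      rw [Finset.mul_sum, Finset.mul_sum, ← Finset.sum_add_distrib]
      refine Finset.sum_congr rfl fun i _ => ?_
      simp only [Pi.add_apply, Pi.smul_apply, smul_eq_mul]
      ring
    rw [e]
    linear_combination (-c.2) * hab
  rw [this]
  positivity

/-- Near each of its points, a polyhedron is a cone. -/
theorem IsPolyhedron.eventually_add_smul_mem_iff {n : ℕ} {σ : Set (Fin n → ℝ)}
    (hσ : IsPolyhedron σ) {x₀ : Fin n → ℝ} (hx₀ : x₀ ∈ σ) :
    ∃ r > 0, ∀ y : Fin n → ℝ, ‖y‖ < r → ∀ ε : ℝ, 0 < ε → ε ≤ 1 →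
      (x₀ + ε • y ∈ σ ↔ x₀ + y ∈ σ) := by
  obtain ⟨s, rfl⟩ := hσ
  -- Inequalities strict at `x₀` stay strict nearby, so only those active at `x₀` matter.
  have key : ∀ᶠ y : Fin n → ℝ in 𝓝 0, ∀ a ∈ s,
      0 < ∑ i, (a.1 i : ℝ) * x₀ i + a.2 → 0 < ∑ i, (a.1 i : ℝ) * (x₀ + y) i + a.2 := by
    refine (Finset.eventually_all s).2 fun a _ => ?_
    by_cases h : 0 < ∑ i, (a.1 i : ℝ) * x₀ i + a.2
    · have hc : Continuous fun y : Fin n → ℝ => ∑ i, (a.1 i : ℝ) * (x₀ + y) i + a.2 := by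
        simp only [Pi.add_apply]
        fun_prop
      have := hc.tendsto 0
      simp only [add_zero] at this
      exact (this.eventually (lt_mem_nhds h)).mono fun y hy _ => hy
    · exact Eventually.of_forall fun y hy => absurd hy h
  obtain ⟨r, hr, H⟩ := Metric.eventually_nhds_iff.1 key
  refine ⟨r, hr, fun y hy ε hε hε1 => ?_⟩
  simp only [mem_ofPred_eq] at hx₀ ⊢
  refine forall₂_congr fun a ha => ?_
  have h0 := hx₀ a ha
  rcases h0.lt_or_eq with h | h
  · have h1 := H (y := y) (by simpa using hy) a ha h
    have h2 := H (y := ε • y) (by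
      rw [dist_zero_right, norm_smul, Real.norm_of_nonneg hε.le]
      exact (mul_le_of_le_one_left (norm_nonneg _) hε1).trans_lt hy) a ha h
    exact ⟨fun _ => h1.le, fun _ => h2.le⟩
  -- An inequality active at `x₀` is homogeneous linear in the displacement, so its sign is
  -- unchanged by a positive factor.
  · have e1 := sum_mul_add_smul a.1 x₀ y ε
    have e2 := sum_mul_add_smul a.1 x₀ y 1
    rw [one_smul, one_mul] at e2
    rw [e1, e2]
    have e3 : ∀ c : ℝ, ∑ i, (a.1 i : ℝ) * x₀ i + c + a.2 = c := fun c => by linarith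
    rw [e3, e3]
    exact mul_nonneg_iff_of_pos_left hε

/-- The equations are the slopes of the defining inequalities that are equalities on all of `σ`.
Integrality of these slopes is what later makes `N_σ` span `L_σ`. -/
theorem IsPolyhedron.vectorSpan_eq {n : ℕ} {σ : Set (Fin n → ℝ)} (hσ : IsPolyhedron σ)
    (hne : σ.Nonempty) : ∃ s : Set (Fin n → ℤ),
      ∀ v, v ∈ vectorSpan ℝ σ ↔ ∀ m ∈ s, ∑ i, (m i : ℝ) * v i = 0 := by
  classical
  obtain ⟨s, rfl⟩ := hσ
  set σ := {x : Fin n → ℝ | ∀ a ∈ s, 0 ≤ ∑ i, (a.1 i : ℝ) * x i + a.2} with hσ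
  have hconv : Convex ℝ σ := IsPolyhedron.convex ⟨s, rfl⟩
  -- A relative interior point: successive midpoints make every inequality strict that is strict
  -- somewhere on `σ`.
  have hint : ∃ x ∈ σ, ∀ a ∈ s, (∃ y ∈ σ, 0 < ∑ i, (a.1 i : ℝ) * y i + a.2) →
      0 < ∑ i, (a.1 i : ℝ) * x i + a.2 := by
    suffices ∀ s' : Finset ((Fin n → ℤ) × ℝ), s' ⊆ s → ∃ x ∈ σ, ∀ a ∈ s',
        (∃ y ∈ σ, 0 < ∑ i, (a.1 i : ℝ) * y i + a.2) → 0 < ∑ i, (a.1 i : ℝ) * x i + a.2 from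
      this s subset_rfl
    intro s'
    induction s' using Finset.induction_on with
    | empty => exact fun _ => ⟨hne.some, hne.some_mem, by simp⟩
    | insert a s' _ ih =>
      intro hs
      obtain ⟨x, hx, hxs⟩ := ih fun b hb => hs (Finset.mem_insert_of_mem hb)
      by_cases h : ∃ y ∈ σ, 0 < ∑ i, (a.1 i : ℝ) * y i + a.2
      · obtain ⟨y, hy, hya⟩ := h
        have hmid : ∀ b : (Fin n → ℤ) × ℝ,
            ∑ i, (b.1 i : ℝ) * ((1 / 2 : ℝ) • x + (1 / 2 : ℝ) • y) i + b.2 =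
            1 / 2 * ((∑ i, (b.1 i : ℝ) * x i + b.2) + (∑ i, (b.1 i : ℝ) * y i + b.2)) := by
          intro b
          have e : ∑ i, (b.1 i : ℝ) * ((1 / 2 : ℝ) • x + (1 / 2 : ℝ) • y) i =
              1 / 2 * ∑ i, (b.1 i : ℝ) * x i + 1 / 2 * ∑ i, (b.1 i : ℝ) * y i := by
            rw [Finset.mul_sum, Finset.mul_sum, ← Finset.sum_add_distrib]
            refine Finset.sum_congr rfl fun i _ => ?_
            simp only [Pi.add_apply, Pi.smul_apply, smul_eq_mul]
            ring
          rw [e]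
          ring
        refine ⟨(1 / 2 : ℝ) • x + (1 / 2 : ℝ) • y,
          hconv hx hy (by norm_num) (by norm_num) (by norm_num), fun b hb hby => ?_⟩
        rw [hmid]
        rcases Finset.mem_insert.1 hb with rfl | hb'
        · have := hx b (hs hb)
          positivity
        · have h1 := hxs b hb' hby
          have h2 := hy b (hs hb)
          positivity
      · refine ⟨x, hx, fun b hb hby => ?_⟩
        rcases Finset.mem_insert.1 hb with rfl | hb'
        · exact absurd hby h
        · exact hxs b hb' hby
  obtain ⟨x, hx, hxs⟩ := hint
  refine ⟨{m | ∃ c, (m, c) ∈ s ∧ ∀ y ∈ σ, ∑ i, (m i : ℝ) * y i + c = 0}, fun v =>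
    ⟨fun hv m ⟨c, _, hc⟩ => ?_, fun hv => ?_⟩⟩
  · rw [vectorSpan_def] at hv
    induction hv using Submodule.span_induction with
    | mem v hv =>
      obtain ⟨y, hy, z, hz, rfl⟩ := hv
      have h1 := hc y hy
      have h2 := hc z hz
      simp only [vsub_eq_sub, Pi.sub_apply, mul_sub, Finset.sum_sub_distrib]
      linarith
    | zero => simp
    | add u v _ _ hu hv =>
      simp only [Pi.add_apply, mul_add, Finset.sum_add_distrib, hu, hv, add_zero]
    | smul r v _ hv =>
      have : ∑ i, (m i : ℝ) * (r • v) i = r * ∑ i, (m i : ℝ) * v i := by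
        rw [Finset.mul_sum]
        refine Finset.sum_congr rfl fun i _ => ?_
        simp only [Pi.smul_apply, smul_eq_mul]
        ring
      rw [this, hv, mul_zero]
  -- From a relative interior point one can move a little along `v` without leaving `σ`, so `v` is a
  -- direction of `σ`.
  · have key : ∀ᶠ ε : ℝ in 𝓝 0, x + ε • v ∈ σ := by
      refine (Finset.eventually_all s).2 fun a ha => ?_
      simp only [sum_mul_add_smul]
      by_cases h : ∃ y ∈ σ, 0 < ∑ i, (a.1 i : ℝ) * y i + a.2
      · have hc : Continuous fun ε : ℝ =>
            ∑ i, (a.1 i : ℝ) * x i + ε * ∑ i, (a.1 i : ℝ) * v i + a.2 := by fun_prop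
        have := hc.tendsto 0
        simp only [zero_mul, add_zero] at this
        exact (this.eventually (lt_mem_nhds (hxs a ha h))).mono fun ε hε => hε.le
      · have h0 : ∀ y ∈ σ, ∑ i, (a.1 i : ℝ) * y i + a.2 = 0 := fun y hy =>
          le_antisymm (not_lt.1 fun h' => h ⟨y, hy, h'⟩) (hy a ha)
        refine Eventually.of_forall fun ε => ?_
        rw [hv a.1 ⟨a.2, ha, h0⟩, mul_zero, add_zero]
        exact hx a ha
    obtain ⟨r, hr, H⟩ := Metric.eventually_nhds_iff.1 key
    have hm := H (y := r / 2) (by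
      rw [dist_zero_right, Real.norm_of_nonneg (by positivity)]
      linarith)
    have h2 := vsub_mem_vectorSpan ℝ hm hx
    rw [vsub_eq_sub, add_sub_cancel_left] at h2
    simpa [smul_smul, hr.ne'] using (vectorSpan ℝ σ).smul_mem (2 / r) h2

/-! ### Lattice frames -/

/-- A subspace cut out by integral equations is spanned by its integral vectors. -/
theorem mem_span_of_forall_sum_eq_zero {n : ℕ} (s : Set (Fin n → ℤ)) (v : Fin n → ℝ)
    (hv : ∀ m ∈ s, ∑ i, (m i : ℝ) * v i = 0) :
    v ∈ Submodule.span ℝ {u : Fin n → ℝ | (∃ z : Fin n → ℤ, ∀ i, u i = z i) ∧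
      ∀ m ∈ s, ∑ i, (m i : ℝ) * u i = 0} := by
  classical
  -- Expanding the entries of `v` in a `ℚ`-basis of `ℝ` writes `v` as a real combination of rational
  -- vectors `q j`. By `ℚ`-independence each `q j` satisfies the same integral equations.
  set B := Module.Basis.ofVectorSpace ℚ ℝ
  let q : _ → Fin n → ℚ := fun j i => B.repr (v i) j
  set J := Finset.univ.biUnion fun i => (B.repr (v i)).support
  have hsum : v = ∑ j ∈ J, (B j) • (fun i => (q j i : ℝ)) := by
    ext i
    have h1 := B.linearCombination_repr (v i)
    rw [Finsupp.linearCombination_apply, Finsupp.sum] at h1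
    rw [← h1, Finset.sum_apply]
    refine (Finset.sum_subset (Finset.subset_biUnion_of_mem
      (fun i => (B.repr (v i)).support) (Finset.mem_univ i)) fun j _ hj => ?_).trans
        (Finset.sum_congr rfl fun j _ => ?_)
    · rw [Finsupp.notMem_support_iff.1 hj, zero_smul]
    · simp [q, Rat.smul_def, mul_comm]
  rw [hsum]
  refine Submodule.sum_mem _ fun j _ => Submodule.smul_mem _ _ ?_
  have hq : ∀ m ∈ s, ∑ i, (m i : ℚ) * q j i = 0 := by
    intro m hm
    have h1 := congrArg (fun x => B.repr x j) (hv m hm)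
    simp only [map_sum, map_zero, Finsupp.coe_zero, Pi.zero_apply, Finsupp.coe_finsetSum,
      Finset.sum_apply] at h1
    rw [← h1]
    refine Finset.sum_congr rfl fun i _ => ?_
    have : (m i : ℝ) * v i = (m i : ℚ) • v i := by simp [Rat.smul_def]
    rw [this, map_smul]
    simp [q]
  -- A common denominator makes `q j` integral.
  obtain ⟨N, hN⟩ := IsLocalization.exist_integer_multiples_of_finset (nonZeroDivisors ℤ)
    (Finset.univ.image (q j))
  have hN0 : ((N : ℤ) : ℝ) ≠ 0 := by exact_mod_cast nonZeroDivisors.coe_ne_zero N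
  have hz : ∀ i, ∃ z : ℤ, (z : ℚ) = (N : ℤ) * q j i := fun i => by
    obtain ⟨z, hz⟩ := hN (q j i) (Finset.mem_image_of_mem _ (Finset.mem_univ i))
    exact ⟨z, by simpa [Algebra.smul_def] using hz⟩
  choose z hz using hz
  have hz' : ∀ i, (z i : ℝ) = (N : ℤ) * (q j i : ℝ) := fun i => by exact_mod_cast hz i
  have : (fun i => (q j i : ℝ)) = ((N : ℤ) : ℝ)⁻¹ • fun i => (z i : ℝ) := by
    ext i
    rw [Pi.smul_apply, smul_eq_mul, hz', inv_mul_cancel_left₀ hN0]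
  rw [this]
  refine Submodule.smul_mem _ _ (Submodule.subset_span ⟨⟨z, fun i => rfl⟩, fun m hm => ?_⟩)
  have h2 : ∑ i, (m i : ℚ) * (z i : ℚ) = 0 := by
    rw [← mul_zero ((N : ℤ) : ℚ), ← hq m hm, Finset.mul_sum]
    refine Finset.sum_congr rfl fun i _ => ?_
    rw [hz]
    ring
  show ∑ i, (m i : ℝ) * (z i : ℝ) = 0
  exact_mod_cast h2

/-- A discrete subgroup has a `ℤ`-basis which is an `ℝ`-basis of the subspace it spans. -/
theorem exists_basis_of_discreteTopology {E : Type*} [NormedAddCommGroup E] [NormedSpace ℝ E]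
    [FiniteDimensional ℝ E] (N : Submodule ℤ E) [DiscreteTopology N] {d : ℕ}
    (hd : Module.finrank ℝ (Submodule.span ℝ (N : Set E)) = d) :
    ∃ b : Fin d → E, LinearIndependent ℝ b ∧ Submodule.span ℤ (Set.range b) = N := by
  -- Inside its own real span, `N` is a lattice of full rank, so the theory of `IsZLattice` applies.
  let f := (Submodule.span ℝ (N : Set E)).subtype
  let L₀ := N.comap (f.restrictScalars ℤ)
  have h_map : L₀.map (f.restrictScalars ℤ) = N := by
    rw [Submodule.map_comap_eq_self]
    exact fun x hx ↦ LinearMap.mem_range.mpr ⟨⟨x, Submodule.subset_span hx⟩, rfl⟩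
  have h_img : f '' L₀ = N := by
    rw [← LinearMap.coe_restrictScalars ℤ f, ← Submodule.map_coe (f.restrictScalars ℤ), h_map]
  have : DiscreteTopology L₀ := by
    refine DiscreteTopology.preimage_of_continuous_injective (N : Set E) ?_
      (Submodule.injective_subtype _)
    exact LinearMap.continuous_of_finiteDimensional f
  have : IsZLattice ℝ L₀ := ⟨by
    rw [← (Submodule.map_injective_of_injective (Submodule.injective_subtype _)).eq_iff,
      Submodule.map_span, Submodule.map_top, Submodule.range_subtype, h_img]⟩
  let b₀ := Module.Free.chooseBasis ℤ L₀
  let b₁ := b₀.ofZLatticeBasis ℝ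
  have hspan : Submodule.span ℤ (Set.range b₁) = L₀ := b₀.ofZLatticeBasis_span ℝ
  let e := Fintype.equivFinOfCardEq ((Module.finrank_eq_card_basis b₁).symm.trans hd)
  refine ⟨f ∘ b₁ ∘ e.symm,
    (b₁.linearIndependent.comp _ e.symm.injective).map' f (Submodule.ker_subtype _), ?_⟩
  rw [Set.range_comp, e.symm.surjective.range_comp,
    ← LinearMap.coe_restrictScalars ℤ f, ← Submodule.map_span, hspan, h_map]

/-- `L_σ` is cut out by integral equations, hence spanned by `N_σ`, whose rank is therefore `d`.
This guarantees that `faceIntegral` does not take its default value `0`. -/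
theorem exists_isLatticeFrame {n d : ℕ} {σ : Set (Fin n → ℝ)} (hσ : IsPolyhedron σ)
    (hne : σ.Nonempty) (hd : Module.finrank ℝ (vectorSpan ℝ σ) = d) :
    ∃ y : (Fin n → ℝ) × (Fin d → (Fin n → ℝ)), IsLatticeFrame σ y.1 y.2 := by
  have hdisc : DiscreteTopology (lattice σ) :=
    DiscreteTopology.of_subset (s := (Submodule.span ℤ (Set.range (Pi.basisFun ℝ (Fin n))) :
      Set (Fin n → ℝ)))
      (inferInstanceAs (DiscreteTopology (Submodule.span ℤ (Set.range (Pi.basisFun ℝ (Fin n))))))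
      fun x hx => hx.2
  have hspan : Submodule.span ℝ (lattice σ : Set (Fin n → ℝ)) = vectorSpan ℝ σ := by
    refine le_antisymm (Submodule.span_le.2 fun x hx => hx.1) fun v hv => ?_
    obtain ⟨s, hs⟩ := hσ.vectorSpan_eq hne
    refine Submodule.span_mono ?_ (mem_span_of_forall_sum_eq_zero s v ((hs v).1 hv))
    rintro u ⟨⟨z, hz⟩, hu⟩
    refine ⟨(hs u).2 hu, ?_⟩
    have : u = ∑ i, z i • Pi.basisFun ℝ (Fin n) i := by
      ext i
      simp [Finset.sum_apply, Pi.single_apply, hz]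
    rw [this]
    exact Submodule.sum_mem _ fun i _ => Submodule.smul_mem _ _ (Submodule.subset_span ⟨i, rfl⟩)
  obtain ⟨b, hb, hbN⟩ := exists_basis_of_discreteTopology (lattice σ) (d := d) (by rw [hspan, hd])
  exact ⟨(hne.some, b), hne.some_mem, hb, hbN⟩

theorem IsLatticeFrame.span_eq {n d : ℕ} {σ : Set (Fin n → ℝ)} {x : Fin n → ℝ}
    {b : Fin d → (Fin n → ℝ)} (h : IsLatticeFrame σ x b)
    (hd : Module.finrank ℝ (vectorSpan ℝ σ) = d) :
    Submodule.span ℝ (Set.range b) = vectorSpan ℝ σ := by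
  refine Submodule.eq_of_le_of_finrank_eq (Submodule.span_le.2 ?_) ?_
  · have : Set.range b ⊆ lattice σ := h.2.2 ▸ Submodule.subset_span
    exact fun v hv => (this hv).1
  · rw [finrank_span_eq_card h.2.1, hd, Fintype.card_fin]

/-! ### The Gram form and its products with functions -/

/-- The `p`-form `dx_{I 0} ∧ ⋯ ∧ dx_{I (p - 1)}`. -/
def coordForm {n p : ℕ} (I : Fin p → Fin n) : (Fin n → ℝ) [⋀^Fin p]→L[ℝ] ℝ :=
  { (Matrix.detRowAlternating (n := Fin p) (R := ℝ)).compLinearMap (LinearMap.funLeft ℝ ℝ I) with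
    cont := by
      have : Continuous fun v : Fin p → Fin n → ℝ =>
          (Matrix.of fun i j => v i (I j)).det := by fun_prop
      exact this }

/-- The constant form `(v, w) ↦ ± p! det (⟨vᵢ, wⱼ⟩)`, a power of `∑ d'xᵢ ∧ d''xᵢ`. -/
def gramForm (n p : ℕ) :
    (Fin n → ℝ) [⋀^Fin p]→L[ℝ] ((Fin n → ℝ) [⋀^Fin p]→L[ℝ] ℝ) :=
  (-1 : ℝ) ^ (p * (p - 1) / 2) • ∑ I : Fin p → Fin n,
    (ContinuousLinearMap.toSpanSingleton ℝ (coordForm I)).compContinuousAlternatingMap (coordForm I)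

theorem gramForm_apply {n p : ℕ} (v w : Fin p → Fin n → ℝ) :
    gramForm n p v w = (-1 : ℝ) ^ (p * (p - 1) / 2) *
      ∑ I : Fin p → Fin n, coordForm I v * coordForm I w := by
  simp [gramForm, ContinuousAlternatingMap.sum_apply]

/-- A form of the Cauchy–Binet formula. -/
theorem sum_det_mul_det {ι κ R : Type*} [Fintype ι] [DecidableEq ι] [Fintype κ] [CommRing R]
    (A B : Matrix ι κ R) :
    ∑ I : ι → κ, (A.submatrix id I).det * (B.submatrix id I).det =
      (Fintype.card ι).factorial * (A * B.transpose).det := by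
  have h1 : (A * B.transpose).det =
      ∑ I : ι → κ, (∏ i, A i (I i)) * (B.submatrix id I).det := by
    rw [← Matrix.det_transpose, Matrix.det_apply]
    simp only [Matrix.transpose_apply, Matrix.mul_apply, Finset.prod_univ_sum,
      Fintype.piFinset_univ, Finset.smul_sum]
    rw [Finset.sum_comm]
    refine Finset.sum_congr rfl fun I _ => ?_
    rw [Matrix.det_apply, Finset.mul_sum]
    refine Finset.sum_congr rfl fun π _ => ?_
    rw [Finset.prod_mul_distrib, mul_smul_comm]
    rfl
  -- Reindexing `I` by `π` permutes the columns of `B`, which accounts for the sign of `π`. So every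
  -- permutation in the Leibniz expansion of the first determinant contributes the same amount,
  -- whence the factorial.
  have h2 : ∀ π : Equiv.Perm ι, ∑ I : ι → κ, ((Equiv.Perm.sign π : ℤ) : R) *
      (∏ i, A (π i) (I i)) * (B.submatrix id I).det = (A * B.transpose).det := by
    intro π
    rw [h1, ← Equiv.sum_comp (Equiv.arrowCongr π (Equiv.refl κ))
      (fun I => (∏ i, A i (I i)) * (B.submatrix id I).det)]
    refine Finset.sum_congr rfl fun I _ => ?_
    have e1 : ∏ i, A i ((Equiv.arrowCongr π (Equiv.refl κ)) I i) = ∏ i, A (π i) (I i) := by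
      rw [← Equiv.prod_comp π]
      simp
    have e2 : (B.submatrix id ((Equiv.arrowCongr π (Equiv.refl κ)) I)).det =
        ((Equiv.Perm.sign π : ℤ) : R) * (B.submatrix id I).det := by
      rw [← Equiv.Perm.sign_inv, ← Matrix.det_permute']
      rfl
    simp only [e1, e2]
    ring
  have h3 : ∀ I : ι → κ, (A.submatrix id I).det * (B.submatrix id I).det =
      ∑ π : Equiv.Perm ι, ((Equiv.Perm.sign π : ℤ) : R) *
        (∏ i, A (π i) (I i)) * (B.submatrix id I).det := by
    intro I
    rw [Matrix.det_apply', Finset.sum_mul]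
    rfl
  simp_rw [h3]
  rw [Finset.sum_comm]
  simp_rw [h2]
  simp [Fintype.card_perm]

theorem gramForm_eq_det {n p : ℕ} (v w : Fin p → Fin n → ℝ) :
    gramForm n p v w = (-1 : ℝ) ^ (p * (p - 1) / 2) *
      (p.factorial * (Matrix.of fun i j => v i ⬝ᵥ w j).det) := by
  rw [gramForm_apply]
  congr 1
  have := sum_det_mul_det (Matrix.of v) (Matrix.of w)
  rw [Fintype.card_fin] at this
  exact this

/-- The Gram form is a sum of terms `α ∧ Jα` with the required sign, and `√φ` is absorbed into `α`.
This holds on the whole space, hence on every cell. -/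
theorem isPositiveAt_smul_gramForm {n p : ℕ} (φ : (Fin n → ℝ) → ℝ) (σ : Set (Fin n → ℝ))
    {x : Fin n → ℝ} (hx : 0 ≤ φ x) :
    IsPositiveAt (fun x => φ x • gramForm n p) σ x := by
  let e := (Fintype.equivFin (Fin p → Fin n)).symm
  refine ⟨_, fun s => √(φ x) • coordForm (e s), fun v w _ _ => ?_⟩
  have : ∑ s, (√(φ x) • coordForm (e s)) v * (√(φ x) • coordForm (e s)) w =
      φ x * ∑ I : Fin p → Fin n, coordForm I v * coordForm I w := by
    rw [Finset.mul_sum, ← Equiv.sum_comp e]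
    refine Finset.sum_congr rfl fun s _ => ?_
    simp only [ContinuousAlternatingMap.smul_apply, smul_eq_mul]
    linear_combination (coordForm (e s) v * coordForm (e s) w) * Real.mul_self_sqrt hx
  rw [this]
  simp only [ContinuousAlternatingMap.smul_apply, gramForm_apply, smul_eq_mul]
  ring

theorem fderiv_smul_const_eq {E F : Type*} [NormedAddCommGroup E] [NormedSpace ℝ E]
    [NormedAddCommGroup F] [NormedSpace ℝ F] {φ : E → ℝ} {x : E} (hφ : DifferentiableAt ℝ φ x)
    (c : F) : fderiv ℝ (fun x => φ x • c) x = (fderiv ℝ φ x).smulRight c :=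
  (hφ.hasFDerivAt.smul_const c).fderiv

theorem fderiv_linearMap_comp_apply {E F G : Type*} [NormedAddCommGroup E] [NormedSpace ℝ E]
    [NormedAddCommGroup F] [NormedSpace ℝ F] [FiniteDimensional ℝ F] [NormedAddCommGroup G]
    [NormedSpace ℝ G] (L : F →ₗ[ℝ] G) {g : E → F} {x : E} (hg : DifferentiableAt ℝ g x) (u : E) :
    fderiv ℝ (fun x => L (g x)) x u = L (fderiv ℝ g x u) := by
  have := (L.toContinuousLinearMap.hasFDerivAt.comp x hg.hasFDerivAt).fderiv
  exact congrArg (fun l => l u) this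

/-- `d''` of `φ κ`, for a constant form `κ`, as a linear function of the differential of `φ`. -/
def dDoublePrimeSmul {n p q : ℕ} (κ : (Fin n → ℝ) [⋀^Fin p]→L[ℝ] ((Fin n → ℝ) [⋀^Fin q]→L[ℝ] ℝ)) :
    ((Fin n → ℝ) →L[ℝ] ℝ) →ₗ[ℝ]
      (Fin n → ℝ) [⋀^Fin p]→L[ℝ] ((Fin n → ℝ) [⋀^Fin (q + 1)]→L[ℝ] ℝ) where
  toFun l := (-1 : ℝ) ^ p • (ContinuousAlternatingMap.alternatizeUncurryFinCLM ℝ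
      (Fin n → ℝ) ℝ).compContinuousAlternatingMap (l.smulRight κ).flipAlternating
  map_add' l l' := by
    ext v w
    simp [ContinuousAlternatingMap.alternatizeUncurryFin_apply, add_mul, mul_add,
      Finset.sum_add_distrib]
  map_smul' r l := by
    ext v w
    simp [ContinuousAlternatingMap.alternatizeUncurryFin_apply, Finset.mul_sum]
    refine Finset.sum_congr rfl fun i _ => ?_
    ring

theorem dDoublePrimeSmul_apply {n p q : ℕ}
    (κ : (Fin n → ℝ) [⋀^Fin p]→L[ℝ] ((Fin n → ℝ) [⋀^Fin q]→L[ℝ] ℝ))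
    (l : (Fin n → ℝ) →L[ℝ] ℝ) (v : Fin p → Fin n → ℝ) (w : Fin (q + 1) → Fin n → ℝ) :
    dDoublePrimeSmul κ l v w =
      (-1 : ℝ) ^ p * ∑ j : Fin (q + 1), (-1 : ℝ) ^ (j : ℕ) * (l (w j) * κ v (j.removeNth w)) := by
  simp [dDoublePrimeSmul, ContinuousAlternatingMap.alternatizeUncurryFin_apply]

theorem dDoublePrime_smul {n p q : ℕ}
    (κ : (Fin n → ℝ) [⋀^Fin p]→L[ℝ] ((Fin n → ℝ) [⋀^Fin q]→L[ℝ] ℝ))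
    {φ : (Fin n → ℝ) → ℝ} (hφ : Differentiable ℝ φ) :
    dDoublePrime (fun x => φ x • κ) =
      fun x => dDoublePrimeSmul κ (fderiv ℝ φ x) := by
  funext x
  have : fderiv ℝ (fun x => φ x • κ) x = (fderiv ℝ φ x).smulRight κ :=
    fderiv_smul_const_eq (hφ x) κ
  rw [dDoublePrime, this]
  rfl

/-- As `κ` is constant, both differentials fall on `φ` and produce its Hessian. The sign `(-1) ^ p`
comes from moving `d''xᵢ` past `p` factors of type `d'`. -/
theorem ddc_smul_apply {n p q : ℕ}
    (κ : (Fin n → ℝ) [⋀^Fin p]→L[ℝ] ((Fin n → ℝ) [⋀^Fin q]→L[ℝ] ℝ))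
    {φ : (Fin n → ℝ) → ℝ} (hφ : ContDiff ℝ ∞ φ) (x : Fin n → ℝ)
    (v : Fin (p + 1) → Fin n → ℝ) (w : Fin (q + 1) → Fin n → ℝ) :
    dPrime (dDoublePrime (fun x => φ x • κ)) x v w =
      (-1 : ℝ) ^ p * ∑ i : Fin (p + 1), ∑ j : Fin (q + 1), (-1 : ℝ) ^ ((i : ℕ) + (j : ℕ)) *
        (fderiv ℝ (fderiv ℝ φ) x (v i) (w j) * κ (i.removeNth v) (j.removeNth w)) := by
  have hd : DifferentiableAt ℝ (fderiv ℝ φ) x :=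
    ((hφ.fderiv_right (m := 1) (by norm_cast)).differentiable (by norm_num)) x
  have hf : ∀ u, fderiv ℝ (fun x => dDoublePrimeSmul κ (fderiv ℝ φ x)) x u =
      dDoublePrimeSmul κ (fderiv ℝ (fderiv ℝ φ) x u) :=
    fun u => fderiv_linearMap_comp_apply
      (G := (Fin n → ℝ) [⋀^Fin p]→L[ℝ] ((Fin n → ℝ) [⋀^Fin (q + 1)]→L[ℝ] ℝ))
      (dDoublePrimeSmul κ) hd u
  rw [dDoublePrime_smul κ (hφ.differentiable (by norm_num)), dPrime, extDeriv,
    ContinuousAlternatingMap.alternatizeUncurryFin_apply, ContinuousAlternatingMap.sum_apply,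
    Finset.mul_sum]
  refine Finset.sum_congr rfl fun i _ => ?_
  simp only [ContinuousAlternatingMap.smul_apply, hf,
    dDoublePrimeSmul_apply, Finset.mul_sum]
  rw [Finset.smul_sum]
  refine Finset.sum_congr rfl fun j _ => ?_
  rw [pow_add, zsmul_eq_mul]
  push_cast
  ring

/-- The signs from the integration convention, from `d''` and from the Gram form cancel. -/
theorem neg_one_pow_aux (p : ℕ) :
    (-1 : ℝ) ^ ((p + 1) * (p + 1 - 1) / 2) * ((-1) ^ p * (-1) ^ (p * (p - 1) / 2)) = 1 := by
  have h : (p + 1) * (p + 1 - 1) / 2 = p + p * (p - 1) / 2 := by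
    cases p with
    | zero => rfl
    | succ k =>
      have : (k + 1 + 1) * (k + 1 + 1 - 1) = (k + 1) * (k + 1 - 1) + (k + 1) * 2 := by
        simp only [Nat.add_sub_cancel]; ring
      rw [this, Nat.add_mul_div_right _ _ (by norm_num), add_comm]
  rw [h, ← pow_add, ← pow_add, Even.neg_one_pow]
  exact ⟨_, rfl⟩

/-- `d'd''(φ κ)` for the Gram form `κ`, in terms of the Gram matrix and the Hessian of `φ`. -/
theorem ddc_smul_gramForm_apply {n p : ℕ} {φ : (Fin n → ℝ) → ℝ} (hφ : ContDiff ℝ ∞ φ)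
    (x : Fin n → ℝ) (b : Fin (p + 1) → Fin n → ℝ) :
    (-1 : ℝ) ^ ((p + 1) * (p + 1 - 1) / 2) *
      dPrime (dDoublePrime (fun x => φ x • gramForm n p)) x b b =
      p.factorial * ((Matrix.of fun i j => fderiv ℝ (fderiv ℝ φ) x (b i) (b j)) *
        (Matrix.of fun i j => b i ⬝ᵥ b j).adjugate).trace := by
  rw [ddc_smul_apply _ hφ, Matrix.trace]
  simp only [Matrix.diag_apply, Matrix.mul_apply, Finset.mul_sum]
  refine Finset.sum_congr rfl fun i _ => Finset.sum_congr rfl fun j _ => ?_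
  -- Evaluated on the remaining vectors, `κ` is a minor of the Gram matrix. With the alternating
  -- signs these minors are the entries of the adjugate.
  rw [Matrix.adjugate_fin_succ_eq_det_submatrix, gramForm_eq_det]
  have e : (Matrix.of fun i j => b i ⬝ᵥ b j).submatrix i.succAbove j.succAbove =
      Matrix.of fun k l => (i.removeNth b) k ⬝ᵥ (j.removeNth b) l := by
    ext; rfl
  rw [e]
  simp only [Matrix.of_apply]
  linear_combination ((-1 : ℝ) ^ ((i : ℕ) + (j : ℕ)) * fderiv ℝ (fderiv ℝ φ) x (b i) (b j) *
    p.factorial * (Matrix.of fun k l => (i.removeNth b) k ⬝ᵥ (j.removeNth b) l).det) *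
    neg_one_pow_aux p

/-! ### Radial test functions -/

/-- The density `χ`, in dimension `d`, with `4 s h' + 2 d h = χ` for `h = s ^ (-d / 2) ∫₀ˢ k`. -/
def radialDensity (d : ℕ) (k : ℝ → ℝ) (s : ℝ) : ℝ := 4 * (s * s ^ (-((d : ℝ) / 2))) * k s

theorem radialDensity_nonneg (d : ℕ) {k : ℝ → ℝ} (hk : ∀ s, 0 ≤ k s) {s : ℝ} (hs : 0 ≤ s) :
    0 ≤ radialDensity d k s := by
  have := hk s
  have := Real.rpow_nonneg hs (-((d : ℝ) / 2))
  unfold radialDensity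
  positivity

/-- The power of `s` is singular only at `0`, and `k` vanishes around there. -/
theorem continuous_radialDensity (d : ℕ) {k : ℝ → ℝ} (hk : Continuous k) {a : ℝ} (ha : 0 < a)
    (hka : ∀ s ≤ a, k s = 0) : Continuous (radialDensity d k) := by
  refine continuous_iff_continuousAt.2 fun s => ?_
  rcases lt_or_ge s a with hs | hs
  · have : radialDensity d k =ᶠ[𝓝 s] fun _ => 0 := by
      filter_upwards [Iio_mem_nhds hs] with r hr
      simp [radialDensity, hka r (le_of_lt hr)]
    exact continuousAt_const.congr this.symm
  · have h1 : ContinuousAt (fun s : ℝ => s ^ (-((d : ℝ) / 2))) s :=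
      Real.continuousAt_rpow_const _ _ (Or.inl (ha.trans_le hs).ne')
    unfold radialDensity
    fun_prop

theorem hasDerivAt_integral_of_continuous {k : ℝ → ℝ} (hk : Continuous k) (a s : ℝ) :
    HasDerivAt (fun s => ∫ r in a..s, k r) (k s) s :=
  intervalIntegral.integral_hasDerivAt_right (hk.intervalIntegrable _ _)
    hk.aestronglyMeasurable.stronglyMeasurableAtFilter hk.continuousAt

theorem contDiff_integral_of_contDiff {k : ℝ → ℝ} (hk : ContDiff ℝ ∞ k) (a : ℝ) :
    ContDiff ℝ ∞ (fun s => ∫ r in a..s, k r) := by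
  refine contDiff_infty_iff_deriv.2
    ⟨fun s => (hasDerivAt_integral_of_continuous hk.continuous a s).differentiableAt, ?_⟩
  have : deriv (fun s => ∫ r in a..s, k r) = k :=
    funext fun s => (hasDerivAt_integral_of_continuous hk.continuous a s).deriv
  rwa [this]

theorem sq_rpow_half (d : ℕ) {ε : ℝ} (hε : 0 < ε) : (ε ^ 2) ^ ((d : ℝ) / 2) = ε ^ d := by
  rw [← Real.rpow_natCast ε 2, ← Real.rpow_mul hε.le, ← Real.rpow_natCast ε d]
  congr 1
  push_cast
  ring

/-- A nonnegative smooth radial profile whose Laplacian in dimension `d` is the difference of a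
nonnegative density and its rescaling. -/
theorem exists_radialProfile (d : ℕ) {k : ℝ → ℝ} (hk : ContDiff ℝ ∞ k) (hk0 : ∀ s, 0 ≤ k s)
    {a b : ℝ} (ha : 0 < a) (hka : ∀ s ≤ a, k s = 0) (hkb : ∀ s, b ≤ s → k s = 0)
    {ε : ℝ} (hε : 0 < ε) (hε1 : ε ≤ 1) :
    ∃ Φ : ℝ → ℝ, ContDiff ℝ ∞ Φ ∧ (∀ s, 0 ≤ Φ s) ∧ (∀ s, b ≤ s → Φ s = 0) ∧
      ∀ s, 0 ≤ s → 4 * s * deriv (deriv Φ) s + 2 * d * deriv Φ s =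
        radialDensity d k s - (ε ^ d)⁻¹ * radialDensity d k (s / ε ^ 2) := by
  have hε2 : 0 < ε ^ 2 := by positivity
  have hε21 : ε ^ 2 ≤ 1 := pow_le_one₀ hε.le hε1
  set W : ℝ → ℝ := fun s => ∫ r in a..s, k r with hW
  have hWd : ∀ s, HasDerivAt W (k s) s := hasDerivAt_integral_of_continuous hk.continuous a
  have hWs : ContDiff ℝ ∞ W := contDiff_integral_of_contDiff hk a
  have hWm : Monotone W := monotone_of_deriv_nonneg (fun s => (hWd s).differentiableAt)
    fun s => by rw [(hWd s).deriv]; exact hk0 s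
  have hWa : ∀ s ≤ a, W s = 0 := fun s hs => by
    rw [hW]
    refine (intervalIntegral.integral_congr (g := fun _ => (0 : ℝ)) fun r hr => ?_).trans (by simp)
    rw [uIcc_of_ge hs] at hr
    exact hka r hr.2
  have hWb : ∀ s r, b ≤ s → s ≤ r → W r = W s := fun s r hs hr => by
    rw [← sub_eq_zero, hW]
    simp only
    rw [intervalIntegral.integral_interval_sub_left (hk.continuous.intervalIntegrable _ _)
      (hk.continuous.intervalIntegrable _ _)]
    refine (intervalIntegral.integral_congr (g := fun _ => (0 : ℝ)) fun x hx => ?_).trans (by simp)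
    rw [uIcc_of_le hr] at hx
    exact hkb x (hs.trans hx.1)
  have hle : ∀ s, 0 ≤ s → s ≤ s / ε ^ 2 := fun s hs => by
    rw [le_div_iff₀ hε2]
    exact mul_le_of_le_one_right hs hε21
  -- This will be `-Φ'`. The factor `s ^ (-d / 2)` solves `4 s h' + 2 d h = 0`, so only the
  -- derivative of the bracket survives. The bracket is nonnegative since `W` is monotone, and zero
  -- for small `s` and for `s ≥ b`, where `W` is constant.
  set h : ℝ → ℝ := fun s => s ^ (-((d : ℝ) / 2)) * (W (s / ε ^ 2) - W s) with hh
  have hsmall : ∀ s < ε ^ 2 * a, W (s / ε ^ 2) = 0 ∧ W s = 0 := fun s hs => by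
    refine ⟨hWa _ ?_, hWa _ (hs.le.trans (mul_le_of_le_one_left ha.le hε21))⟩
    rw [div_le_iff₀ hε2]
    linarith
  have h0 : ∀ s < ε ^ 2 * a, h s = 0 := fun s hs => by
    simp [hh, hsmall s hs]
  have hsm : 0 < ε ^ 2 * a := by positivity
  have hnn : ∀ s, 0 ≤ h s := fun s => by
    rcases lt_or_ge s 0 with hs | hs
    · exact (h0 s (hs.trans hsm)).ge
    · exact mul_nonneg (Real.rpow_nonneg hs _) (sub_nonneg.2 (hWm (hle s hs)))
  have hb : ∀ s, b ≤ s → h s = 0 := fun s hs => by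
    rcases lt_or_ge s 0 with hs' | hs'
    · exact h0 s (hs'.trans hsm)
    · simp [hh, hWb s _ hs (hle s hs')]
  have hcd : ContDiff ℝ ∞ h := by
    refine contDiff_iff_contDiffAt.2 fun s => ?_
    rcases lt_or_ge s (ε ^ 2 * a) with hs | hs
    · have : h =ᶠ[𝓝 s] fun _ => 0 := by
        filter_upwards [Iio_mem_nhds hs] with r hr using h0 r hr
      exact contDiffAt_const.congr_of_eventuallyEq this
    · have h1 : ContDiffAt ℝ ∞ (fun s : ℝ => s ^ (-((d : ℝ) / 2))) s :=
        Real.contDiffAt_rpow_const_of_ne (hsm.trans_le hs).ne'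
      have h2 : ContDiff ℝ ∞ fun s => W (s / ε ^ 2) - W s :=
        (hWs.comp (contDiff_id.div_const _)).sub hWs
      exact h1.mul h2.contDiffAt
  have hderiv : ∀ s, 0 < s → HasDerivAt h (-((d : ℝ) / 2) * s ^ (-((d : ℝ) / 2) - 1) *
      (W (s / ε ^ 2) - W s) + s ^ (-((d : ℝ) / 2)) * (k (s / ε ^ 2) * (1 / ε ^ 2) - k s)) s := by
    intro s hs
    have h1 := Real.hasDerivAt_rpow_const (x := s) (p := -((d : ℝ) / 2)) (Or.inl hs.ne')
    have h2 : HasDerivAt (fun s => W (s / ε ^ 2)) (k (s / ε ^ 2) * (1 / ε ^ 2)) s :=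
      HasDerivAt.comp (h := fun s => s / ε ^ 2) s (hWd (s / ε ^ 2))
        ((hasDerivAt_id' s).div_const (ε ^ 2))
    exact h1.mul (h2.sub (hWd s))
  -- Integrating from `b` makes `Φ s = ∫ₛᵇ h`: zero beyond `b`, nonnegative before.
  set Φ : ℝ → ℝ := fun s => - ∫ r in b..s, h r with hΦ
  have hΦd : ∀ s, HasDerivAt Φ (-h s) s := fun s =>
    (hasDerivAt_integral_of_continuous hcd.continuous b s).neg
  have hΦ' : deriv Φ = fun s => -h s := funext fun s => (hΦd s).deriv
  have hΦb : ∀ s, b ≤ s → Φ s = 0 := fun s hs => by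
    rw [hΦ]
    simp only [neg_eq_zero]
    refine (intervalIntegral.integral_congr (g := fun _ => (0 : ℝ)) fun r hr => ?_).trans (by simp)
    rw [uIcc_of_le hs] at hr
    exact hb r hr.1
  refine ⟨Φ, (contDiff_integral_of_contDiff hcd b).neg, fun s => ?_, hΦb, fun s hs => ?_⟩
  · rcases le_total b s with hs | hs
    · exact (hΦb s hs).ge
    · rw [hΦ]
      simp only
      rw [← intervalIntegral.integral_symm]
      exact intervalIntegral.integral_nonneg hs fun r _ => hnn r
  · rw [hΦ']
    rcases hs.eq_or_lt with rfl | hs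
    · simp [h0 0 hsm, radialDensity]
    · have e1 : deriv (fun s => -h s) s = _ := (hderiv s hs).neg.deriv
      rw [e1]
      have e2 : s ^ (-((d : ℝ) / 2) - 1) = s ^ (-((d : ℝ) / 2)) / s := by
        rw [Real.rpow_sub hs, Real.rpow_one]
      have e3 : (s / ε ^ 2) ^ (-((d : ℝ) / 2)) = s ^ (-((d : ℝ) / 2)) * ε ^ d := by
        rw [Real.div_rpow hs.le hε2.le, Real.rpow_neg hε2.le, sq_rpow_half d hε, div_inv_eq_mul]
      rw [e2, hh]
      simp only [radialDensity]
      rw [e3]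
      field_simp
      ring

/-- The standard inner product of `ℝⁿ` as a continuous bilinear map. -/
def dotCLM (n : ℕ) : (Fin n → ℝ) →L[ℝ] (Fin n → ℝ) →L[ℝ] ℝ :=
  ∑ i, (ContinuousLinearMap.proj (R := ℝ) (φ := fun _ : Fin n => ℝ) i).smulRight
    (ContinuousLinearMap.proj (R := ℝ) (φ := fun _ : Fin n => ℝ) i)

theorem dotCLM_apply {n : ℕ} (u v : Fin n → ℝ) : dotCLM n u v = u ⬝ᵥ v := by
  simp [dotCLM, dotProduct]

/-- The radial function with profile `Φ` and centre `x₀`. -/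
def radial {n : ℕ} (Φ : ℝ → ℝ) (x₀ x : Fin n → ℝ) : ℝ := Φ ((x - x₀) ⬝ᵥ (x - x₀))

theorem contDiff_dotProduct_sub {n : ℕ} (x₀ : Fin n → ℝ) :
    ContDiff ℝ ∞ fun x : Fin n → ℝ => (x - x₀) ⬝ᵥ (x - x₀) := by
  unfold dotProduct
  simp only [Pi.sub_apply]
  fun_prop

theorem contDiff_radial {n : ℕ} {Φ : ℝ → ℝ} (hΦ : ContDiff ℝ ∞ Φ) (x₀ : Fin n → ℝ) :
    ContDiff ℝ ∞ (radial Φ x₀) :=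
  hΦ.comp (contDiff_dotProduct_sub x₀)

theorem hasFDerivAt_dotProduct_sub {n : ℕ} (x₀ x : Fin n → ℝ) :
    HasFDerivAt (fun x : Fin n → ℝ => (x - x₀) ⬝ᵥ (x - x₀)) ((2 : ℝ) • dotCLM n (x - x₀)) x := by
  have h1 : HasFDerivAt (fun x : Fin n → ℝ => x - x₀) (ContinuousLinearMap.id ℝ _) x :=
    (hasFDerivAt_id x).sub_const x₀
  have h2 := ((dotCLM n).hasFDerivAt.comp x h1).clm_apply h1
  have h3 : HasFDerivAt (fun x : Fin n → ℝ => (x - x₀) ⬝ᵥ (x - x₀)) _ x :=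
    h2.congr_of_eventuallyEq (Eventually.of_forall fun y => (dotCLM_apply _ _).symm)
  refine h3.congr_fderiv (ContinuousLinearMap.ext fun v => ?_)
  simp [dotCLM_apply, dotProduct_comm v, two_mul]

theorem fderiv_radial {n : ℕ} {Φ : ℝ → ℝ} (hΦ : ContDiff ℝ ∞ Φ) (x₀ : Fin n → ℝ) :
    fderiv ℝ (radial Φ x₀) =
      fun x => (deriv Φ ((x - x₀) ⬝ᵥ (x - x₀)) * 2) • dotCLM n (x - x₀) := by
  funext x
  have h1 := ((hΦ.differentiable (by norm_num)) ((x - x₀) ⬝ᵥ (x - x₀))).hasDerivAt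
  have h2 := h1.comp_hasFDerivAt x (hasFDerivAt_dotProduct_sub x₀ x)
  rw [mul_smul]
  exact h2.fderiv

theorem fderiv_fderiv_radial {n : ℕ} {Φ : ℝ → ℝ} (hΦ : ContDiff ℝ ∞ Φ) (x₀ x u v : Fin n → ℝ) :
    fderiv ℝ (fderiv ℝ (radial Φ x₀)) x u v =
      4 * deriv (deriv Φ) ((x - x₀) ⬝ᵥ (x - x₀)) * (((x - x₀) ⬝ᵥ u) * ((x - x₀) ⬝ᵥ v)) +
      2 * deriv Φ ((x - x₀) ⬝ᵥ (x - x₀)) * (u ⬝ᵥ v) := by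
  rw [fderiv_radial hΦ]
  have hd : ContDiff ℝ ∞ (deriv Φ) := (contDiff_infty_iff_deriv.1 hΦ).2
  have h1 := ((hd.differentiable (by norm_num)) ((x - x₀) ⬝ᵥ (x - x₀))).hasDerivAt
  have h2 := (h1.comp_hasFDerivAt x (hasFDerivAt_dotProduct_sub x₀ x)).mul_const 2
  have h3 : HasFDerivAt (fun x : Fin n → ℝ => x - x₀) (ContinuousLinearMap.id ℝ _) x :=
    (hasFDerivAt_id x).sub_const x₀
  have h4 := h2.fun_smul ((dotCLM n).hasFDerivAt.comp x h3)
  have h5 := h4.fderiv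
  simp only [Function.comp_def] at h5
  rw [h5]
  simp [dotCLM_apply]
  ring

/-- On a `(p + 1)`-dimensional space, `d'd''` of a radial function times the Gram form is the
Laplacian of the radial profile in dimension `p + 1`. -/
theorem ddc_radial_smul_gramForm_apply {n p : ℕ} {Φ : ℝ → ℝ} (hΦ : ContDiff ℝ ∞ Φ)
    (x₀ : Fin n → ℝ) (b : Fin (p + 1) → Fin n → ℝ) (t : Fin (p + 1) → ℝ) :
    (-1 : ℝ) ^ ((p + 1) * (p + 1 - 1) / 2) *
      dPrime (dDoublePrime (fun x => radial Φ x₀ x • gramForm n p)) (param x₀ b t) b b =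
    p.factorial * (Matrix.of fun i j => b i ⬝ᵥ b j).det *
      (4 * ((∑ i, t i • b i) ⬝ᵥ (∑ i, t i • b i)) *
        deriv (deriv Φ) ((∑ i, t i • b i) ⬝ᵥ (∑ i, t i • b i)) +
        2 * ((p + 1 : ℕ) : ℝ) * deriv Φ ((∑ i, t i • b i) ⬝ᵥ (∑ i, t i • b i))) := by
  rw [ddc_smul_gramForm_apply (contDiff_radial hΦ x₀)]
  simp only [fderiv_fderiv_radial hΦ]
  have hy : param x₀ b t - x₀ = ∑ i, t i • b i := by simp [param]
  rw [hy]
  set y := ∑ i, t i • b i with hyd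
  set G : Matrix (Fin (p + 1)) (Fin (p + 1)) ℝ := Matrix.of fun i j => b i ⬝ᵥ b j with hG
  set u : Fin (p + 1) → ℝ := fun i => y ⬝ᵥ b i with hu
  have hGt : G.mulVec t = u := by
    ext i
    simp only [hG, hu, hyd, Matrix.mulVec, Matrix.of_apply]
    rw [sum_dotProduct]
    simp only [smul_dotProduct, smul_eq_mul]
    exact Finset.sum_congr rfl fun j _ => by
      rw [mul_comm, dotProduct_comm (b j)]
  -- The Hessian on the frame is a rank-one term plus a multiple of `G`. Since `u = G t`, pairing
  -- with the adjugate gives `det G` times `y ⬝ᵥ y` for the first and `det G` times the dimension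
  -- for the second.
  have hH : (Matrix.of fun i j => 4 * deriv (deriv Φ) (y ⬝ᵥ y) * ((y ⬝ᵥ b i) * (y ⬝ᵥ b j)) +
      2 * deriv Φ (y ⬝ᵥ y) * (b i ⬝ᵥ b j)) =
      (4 * deriv (deriv Φ) (y ⬝ᵥ y)) • Matrix.vecMulVec u u + (2 * deriv Φ (y ⬝ᵥ y)) • G := by
    ext i j
    simp [Matrix.vecMulVec_apply, hG, hu]
  have htr : (Matrix.vecMulVec u u * G.adjugate).trace = G.det * (y ⬝ᵥ y) := by
    rw [Matrix.trace_mul_comm, Matrix.mul_vecMulVec, Matrix.trace_vecMulVec]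
    have : G.adjugate.mulVec u = G.det • t := by
      rw [← hGt, Matrix.mulVec_mulVec, Matrix.adjugate_mul, Matrix.smul_mulVec, Matrix.one_mulVec]
    rw [this, smul_dotProduct, smul_eq_mul]
    congr 1
    conv_rhs => rw [hyd, sum_dotProduct, ← hyd]
    simp only [dotProduct, hu, Pi.smul_apply, smul_eq_mul, Finset.mul_sum]
    refine Finset.sum_congr rfl fun i _ => Finset.sum_congr rfl fun j _ => ?_
    ring
  rw [hH, add_mul, Matrix.trace_add, smul_mul_assoc, smul_mul_assoc, Matrix.trace_smul,
    Matrix.trace_smul, htr, Matrix.mul_adjugate, Matrix.trace_smul, Matrix.trace_one,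
    Fintype.card_fin]
  simp only [smul_eq_mul]
  ring

/-! ### Integrals over one cell -/

/-- Substitute `ε • t` for `t`: the Jacobian cancels `(ε ^ d)⁻¹`, and where `χ` can be nonzero the
domain is unchanged because `S` is a cone there. -/
theorem setIntegral_comp_smul_eq {d : ℕ} {S : Set (Fin d → ℝ)} {q F X : (Fin d → ℝ) → ℝ}
    {χ : ℝ → ℝ} {r ε : ℝ} (hε : 0 < ε) (hε1 : ε ≤ 1) (hq0 : ∀ t, 0 ≤ q t)
    (hq : ∀ t, q (ε • t) = ε ^ 2 * q t) (hX : ∀ t, X t = χ (q t)) (hχ : ∀ s, r ≤ s → χ s = 0)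
    (hT : MeasurableSet {t | t ∈ S ∧ q t ≤ r})
    (hS : ∀ t, q t ≤ r → (ε • t ∈ S ↔ t ∈ S)) :
    ∫ t in {t | t ∈ S ∧ q t ≤ r}, F t * ((ε ^ d)⁻¹ * χ (q t / ε ^ 2)) =
      ∫ t in {t | t ∈ S ∧ q t ≤ r}, F (ε • t) * X t := by
  set T := {t | t ∈ S ∧ q t ≤ r} with hTd
  have h1 := Measure.integral_comp_smul (μ := (volume : Measure (Fin d → ℝ)))
    (T.indicator fun t => F t * χ (q t / ε ^ 2)) ε
  rw [Module.finrank_fin_fun, abs_of_pos (by positivity), smul_eq_mul, integral_indicator hT,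
    ← integral_const_mul] at h1
  have h2 : ∫ t in T, F t * ((ε ^ d)⁻¹ * χ (q t / ε ^ 2)) =
      ∫ t in T, (ε ^ d)⁻¹ * (F t * χ (q t / ε ^ 2)) := by
    congr 1
    ext t
    ring
  rw [h2, ← h1, ← integral_indicator hT]
  congr 1
  ext t
  have hεq : q (ε • t) / ε ^ 2 = q t := by
    rw [hq]
    field_simp
  by_cases h : r ≤ q t
  · rw [indicator_apply_eq_zero.2 fun _ => by rw [hεq, hχ _ h, mul_zero],
      indicator_apply_eq_zero.2 fun _ => by rw [hX, hχ _ h, mul_zero]]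
  · have hlt := not_le.1 h
    have hmem : ε • t ∈ T ↔ t ∈ T := by
      simp only [hTd, mem_ofPred_eq, hS t hlt.le, hlt.le, and_true, and_iff_left_iff_imp]
      intro _
      rw [hq]
      exact (mul_le_of_le_one_left (hq0 t) (pow_le_one₀ hε.le hε1)).trans hlt.le
    by_cases ht : t ∈ T
    · rw [indicator_of_mem (hmem.2 ht), indicator_of_mem ht, hεq, hX]
    · rw [indicator_of_notMem (fun h' => ht (hmem.1 h')), indicator_of_notMem ht]

/-- Dominated convergence: `F` is bounded on the compact set `T`, which is star-shaped about `0`. -/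
theorem tendsto_setIntegral_comp_smul {d : ℕ} {T : Set (Fin d → ℝ)} (hT : IsCompact T)
    (h0 : (0 : Fin d → ℝ) ∈ T) (hstar : ∀ t ∈ T, ∀ ε : ℝ, 0 < ε → ε ≤ 1 → ε • t ∈ T)
    {F X : (Fin d → ℝ) → ℝ} (hF : ContinuousOn F T) (hX : ContinuousOn X T) :
    Tendsto (fun ε : ℝ => ∫ t in T, F (ε • t) * X t) (𝓝[>] 0) (𝓝 (∫ t in T, F 0 * X t)) := by
  obtain ⟨M, hM⟩ := hT.exists_bound_of_continuousOn hF
  have hev : ∀ᶠ ε : ℝ in 𝓝[>] 0, 0 < ε ∧ ε ≤ 1 := by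
    filter_upwards [self_mem_nhdsWithin, nhdsWithin_le_nhds (Iio_mem_nhds one_pos)] with ε h1 h2
    exact ⟨h1, le_of_lt h2⟩
  refine tendsto_integral_filter_of_dominated_convergence (fun t => M * ‖X t‖) ?_ ?_ ?_ ?_
  · filter_upwards [hev] with ε hε
    refine ContinuousOn.aestronglyMeasurable (ContinuousOn.mul ?_ hX) hT.measurableSet
    exact hF.comp (continuous_const_smul ε).continuousOn fun t ht => hstar t ht ε hε.1 hε.2
  · filter_upwards [hev] with ε hε
    refine ae_restrict_of_forall_mem hT.measurableSet fun t ht => ?_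
    rw [norm_mul]
    exact mul_le_mul_of_nonneg_right (hM _ (hstar t ht ε hε.1 hε.2)) (norm_nonneg _)
  · exact (continuousOn_const.mul hX.norm).integrableOn_compact hT
  · refine ae_restrict_of_forall_mem hT.measurableSet fun t ht => Tendsto.mul_const _ ?_
    refine Tendsto.comp (hF 0 h0) (tendsto_nhdsWithin_iff.2 ⟨?_, ?_⟩)
    · have : Tendsto (fun ε : ℝ => ε • t) (𝓝 0) (𝓝 ((0 : ℝ) • t)) :=
        (continuous_id.smul continuous_const).tendsto 0
      rw [zero_smul] at this
      exact this.mono_left nhdsWithin_le_nhds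
    · filter_upwards [hev] with ε hε using hstar t ht ε hε.1 hε.2

/-- A nonpositive function with zero integral vanishes almost everywhere. Continuity upgrades this
to every point, boundary points included, because a convex set with interior lies in the closure of
its interior. -/
theorem eq_zero_of_setIntegral_eq_zero {d : ℕ} {S : Set (Fin d → ℝ)} (hS : Convex ℝ S)
    (hSi : (interior S).Nonempty) {q : (Fin d → ℝ) → ℝ} (hq : Continuous q) {r : ℝ}
    (hT : IsCompact {t | t ∈ S ∧ q t ≤ r}) {g : (Fin d → ℝ) → ℝ}
    (hg : ContinuousOn g {t | t ∈ S ∧ q t ≤ r}) (hg0 : ∀ t ∈ S, q t ≤ r → g t ≤ 0)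
    (hint : ∫ t in {t | t ∈ S ∧ q t ≤ r}, g t = 0) : ∀ t ∈ S, q t < r → g t = 0 := by
  have h1 : ∫ t in {t | t ∈ S ∧ q t ≤ r}, -g t = 0 := by rw [integral_neg, hint, neg_zero]
  have h2 := (setIntegral_eq_zero_iff_of_nonneg_ae
    (ae_restrict_of_forall_mem hT.measurableSet fun t ht => neg_nonneg.2 (hg0 t ht.1 ht.2))
    (hg.neg.integrableOn_compact hT)).1 h1
  have hsub : S ∩ {t | q t < r} ⊆ {t | t ∈ S ∧ q t ≤ r} := fun t ht => ⟨ht.1, le_of_lt ht.2⟩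
  have hopen : IsOpen {t | q t < r} := isOpen_lt hq continuous_const
  have h3 := Measure.eqOn_of_ae_eq (ae_restrict_of_ae_restrict_of_subset hsub h2)
    (hg.neg.mono hsub) continuousOn_const (by
      rw [interior_inter, hopen.interior_eq]
      rintro t ⟨ht, htq⟩
      have : t ∈ closure (interior S) := by
        rw [hS.closure_interior_eq_closure_of_nonempty_interior hSi]
        exact subset_closure ht
      exact hopen.closure_inter ⟨this, htq⟩)
  exact fun t ht htq => neg_eq_zero.1 (h3 ⟨ht, htq⟩)

/-- The norm here is the sup norm, while the test functions are Euclidean radial; this places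
Euclidean balls inside metric ones. -/
theorem norm_sq_le_dotProduct {n : ℕ} (y : Fin n → ℝ) : ‖y‖ ^ 2 ≤ y ⬝ᵥ y := by
  have h0 : 0 ≤ y ⬝ᵥ y := Finset.sum_nonneg fun i _ => mul_self_nonneg _
  have : ‖y‖ ≤ √(y ⬝ᵥ y) := (pi_norm_le_iff_of_nonneg (Real.sqrt_nonneg _)).2 fun i => by
    refine Real.abs_le_sqrt ?_
    rw [pow_two]
    exact Finset.single_le_sum (f := fun i => y i * y i) (fun i _ => mul_self_nonneg _)
      (Finset.mem_univ i)
  calc ‖y‖ ^ 2 ≤ √(y ⬝ᵥ y) ^ 2 := by gcongr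
    _ = y ⬝ᵥ y := Real.sq_sqrt h0

theorem isCompact_dotProduct_sub_le {n : ℕ} (x₀ : Fin n → ℝ) (r : ℝ) :
    IsCompact {x : Fin n → ℝ | (x - x₀) ⬝ᵥ (x - x₀) ≤ r} := by
  refine Metric.isCompact_of_isClosed_isBounded
    (isClosed_le (contDiff_dotProduct_sub x₀).continuous continuous_const) ?_
  refine (Metric.isBounded_closedBall (x := x₀) (r := √r)).subset fun x hx => ?_
  rw [mem_closedBall_iff_norm]
  exact Real.le_sqrt_of_sq_le ((norm_sq_le_dotProduct _).trans hx)

theorem det_gram_pos {n d : ℕ} {b : Fin d → Fin n → ℝ} (hb : LinearIndependent ℝ b) :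
    0 < (Matrix.of fun i j => b i ⬝ᵥ b j).det := by
  have h : (Matrix.of fun i j => b i ⬝ᵥ b j) = Matrix.of b * (Matrix.of b).conjTranspose := by
    ext i j
    simp [Matrix.mul_apply, dotProduct]
  rw [h]
  exact (Matrix.PosDef.mul_conjTranspose_self _
    (Matrix.vecMul_injective_iff.2 hb)).det_pos

/-- The integral over a cell in coordinates centred at a given point of the cell. -/
theorem exists_faceIntegral_eq {n d : ℕ} {U σ : Set (Fin n → ℝ)} (hσ : IsPolyhedron σ)
    {x₀ : Fin n → ℝ} (hx₀ : x₀ ∈ σ) (hd : Module.finrank ℝ (vectorSpan ℝ σ) = d) :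
    ∃ b : Fin d → Fin n → ℝ, LinearIndependent ℝ b ∧
      Submodule.span ℝ (Set.range b) = vectorSpan ℝ σ ∧
      ∀ β : LagerbergForm n d d, faceIntegral U σ β =
        ∫ t in {t | param x₀ b t ∈ σ ∩ U},
          (-1 : ℝ) ^ (d * (d - 1) / 2) * β (param x₀ b t) b b := by
  have h := exists_isLatticeFrame hσ ⟨x₀, hx₀⟩ hd
  have hs := h.choose_spec
  refine ⟨h.choose.2, hs.2.1, hs.span_eq hd, fun β => ?_⟩
  rw [faceIntegral, dif_pos h]
  -- The chosen frame has an arbitrary base point in `σ`. Translating by the coordinates `t₀` of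
  -- `x₀` preserves Lebesgue measure.
  obtain ⟨t₀, ht₀⟩ : ∃ t₀ : Fin d → ℝ, ∑ i, t₀ i • h.choose.2 i = x₀ - h.choose.1 := by
    rw [← Submodule.mem_span_range_iff_exists_fun, hs.span_eq hd]
    exact vsub_mem_vectorSpan ℝ hx₀ hs.1
  have hp : ∀ t, param h.choose.1 h.choose.2 (t + t₀) = param x₀ h.choose.2 t := fun t => by
    simp only [param, Pi.add_apply, add_smul, Finset.sum_add_distrib, ht₀]
    abel
  have hpre : {t | param x₀ h.choose.2 t ∈ σ ∩ U} =
      (fun t => t + t₀) ⁻¹' {t | param h.choose.1 h.choose.2 t ∈ σ ∩ U} := by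
    ext t
    simp only [mem_preimage, mem_ofPred_eq, hp]
  rw [hpre, ← (measurePreserving_add_right volume t₀).setIntegral_preimage_emb
    (measurableEmbedding_addRight t₀)]
  simp only [hp]

/-- The directions of the preimage map onto `L_σ`, so by dimension they fill the parameter space. -/
theorem interior_param_preimage_nonempty {n d : ℕ} {σ : Set (Fin n → ℝ)} (hσ : Convex ℝ σ)
    {x₀ : Fin n → ℝ} (hx₀ : x₀ ∈ σ) (hd : Module.finrank ℝ (vectorSpan ℝ σ) = d)
    {b : Fin d → Fin n → ℝ} (hb : Submodule.span ℝ (Set.range b) = vectorSpan ℝ σ) :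
    Convex ℝ {t | param x₀ b t ∈ σ} ∧ (interior {t | param x₀ b t ∈ σ}).Nonempty := by
  set S := {t | param x₀ b t ∈ σ} with hS
  have h0 : (0 : Fin d → ℝ) ∈ S := by simpa [hS, param] using hx₀
  have hconv : Convex ℝ S := by
    have : S = Fintype.linearCombination ℝ b ⁻¹' ((fun z => x₀ + z) ⁻¹' σ) := rfl
    rw [this]
    exact (hσ.translate_preimage_right x₀).linear_preimage _
  refine ⟨hconv, hconv.interior_nonempty_iff_affineSpan_eq_top.2 ?_⟩
  rw [AffineSubspace.affineSpan_eq_top_iff_vectorSpan_eq_top_of_nonempty ℝ _ _ ⟨0, h0⟩]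
  have hle : vectorSpan ℝ σ ≤ (vectorSpan ℝ S).map (Fintype.linearCombination ℝ b) := by
    rw [vectorSpan_eq_span_vsub_set_right ℝ hx₀, Submodule.span_le]
    rintro _ ⟨x, hx, rfl⟩
    have hxm : x -ᵥ x₀ ∈ Submodule.span ℝ (Set.range b) := hb ▸ vsub_mem_vectorSpan ℝ hx hx₀
    obtain ⟨t, ht⟩ := (Submodule.mem_span_range_iff_exists_fun ℝ).1 hxm
    have htS : t ∈ S := by
      simp only [hS, mem_ofPred_eq, param, ht]
      simpa using hx
    refine ⟨t, ?_, ht⟩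
    simpa using vsub_mem_vectorSpan ℝ htS h0
  refine Submodule.eq_top_of_finrank_eq (le_antisymm (Submodule.finrank_le _) ?_)
  rw [Module.finrank_fin_fun]
  calc d = _ := hd.symm
    _ ≤ _ := Submodule.finrank_mono hle
    _ ≤ _ := Submodule.finrank_map_le _ _

/-- The contribution of one cell to `∫ f d'd''η` for the radial test forms `η` at scale `ε`, and
its limit as `ε` tends to `0`. -/
theorem exists_tendsto_faceIntegral {n p : ℕ} {U σ : Set (Fin n → ℝ)} (hU : IsOpen U)
    (hσ : IsPolyhedron σ) {x₀ : Fin n → ℝ} (hx₀ : x₀ ∈ σ)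
    (hd : Module.finrank ℝ (vectorSpan ℝ σ) = p + 1) {r : ℝ} (hr : 0 < r)
    (hrU : ∀ x, (x - x₀) ⬝ᵥ (x - x₀) ≤ r → x ∈ U)
    (hcone : ∀ y : Fin n → ℝ, y ⬝ᵥ y ≤ r → ∀ ε : ℝ, 0 < ε → ε ≤ 1 →
      (x₀ + ε • y ∈ σ ↔ x₀ + y ∈ σ))
    {f : (Fin n → ℝ) → ℝ} (hf : ContinuousOn f (σ ∩ U))
    (hmax : ∀ x ∈ σ, (x - x₀) ⬝ᵥ (x - x₀) ≤ r → f x ≤ f x₀)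
    {χ : ℝ → ℝ} (hχ : Continuous χ) (hχ0 : ∀ s, 0 ≤ s → 0 ≤ χ s) (hχr : ∀ s, r ≤ s → χ s = 0) :
    ∃ (J : ℝ → ℝ) (J₀ : ℝ),
      (∀ ε : ℝ, 0 < ε → ε ≤ 1 → ∀ Φ : ℝ → ℝ, ContDiff ℝ ∞ Φ →
        (∀ s, 0 ≤ s → 4 * s * deriv (deriv Φ) s + 2 * ((p + 1 : ℕ) : ℝ) * deriv Φ s =
          χ s - (ε ^ (p + 1))⁻¹ * χ (s / ε ^ 2)) →
        faceIntegral U σ (fun x => f x •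
          dPrime (dDoublePrime fun x => radial Φ x₀ x • gramForm n p) x) = J ε) ∧
      Tendsto J (𝓝[>] 0) (𝓝 J₀) ∧ J₀ ≤ 0 ∧
      (J₀ = 0 → ∀ x ∈ σ, (x - x₀) ⬝ᵥ (x - x₀) < r → χ ((x - x₀) ⬝ᵥ (x - x₀)) ≠ 0 →
        f x = f x₀) := by
  obtain ⟨b, hb, hbs, hI⟩ := exists_faceIntegral_eq (U := U) hσ hx₀ hd
  obtain ⟨hSconv, hSint⟩ := interior_param_preimage_nonempty hσ.convex hx₀ hd hbs
  set B := Fintype.linearCombination ℝ b with hB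
  have hBinj : Function.Injective B := hb.fintypeLinearCombination_injective
  have hBc : Continuous B := B.continuous_of_finiteDimensional
  have hpar : ∀ t, param x₀ b t = x₀ + B t := fun t => rfl
  have hparc : Continuous (param x₀ b) := continuous_const.add hBc
  set q : (Fin (p + 1) → ℝ) → ℝ := fun t => B t ⬝ᵥ B t with hq
  have hq0 : ∀ t, 0 ≤ q t := fun t => Finset.sum_nonneg fun i _ => mul_self_nonneg _
  have hqc : Continuous q := hBc.dotProduct hBc
  have hqs : ∀ (ε : ℝ) t, q (ε • t) = ε ^ 2 * q t := fun ε t => by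
    simp only [hq, map_smul, smul_dotProduct, dotProduct_smul, smul_eq_mul]
    ring
  have hqp : ∀ t, (param x₀ b t - x₀) ⬝ᵥ (param x₀ b t - x₀) = q t := fun t => by
    simp only [hpar, add_sub_cancel_left, hq]
  set S : Set (Fin (p + 1) → ℝ) := {t | param x₀ b t ∈ σ} with hS
  set T : Set (Fin (p + 1) → ℝ) := {t | t ∈ S ∧ q t ≤ r} with hT
  have hemb : IsClosedEmbedding (param x₀ b) :=
    (Homeomorph.addLeft x₀).isClosedEmbedding.comp
      (LinearMap.isClosedEmbedding_of_injective (LinearMap.ker_eq_bot.2 hBinj))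
  have hTc : IsCompact T := by
    have : T = param x₀ b ⁻¹' (σ ∩ {x | (x - x₀) ⬝ᵥ (x - x₀) ≤ r}) := by
      ext t
      simp only [hT, hS, mem_ofPred_eq, mem_preimage, mem_inter_iff, hqp]
    rw [this]
    exact hemb.isCompact_preimage ((isCompact_dotProduct_sub_le x₀ r).inter_left hσ.isClosed)
  have hT0 : (0 : Fin (p + 1) → ℝ) ∈ T := by
    refine ⟨?_, ?_⟩
    · simpa [hS, hpar] using hx₀
    · simpa [hq] using hr.le
  have hTU : MapsTo (param x₀ b) T (σ ∩ U) := fun t ht => ⟨ht.1, hrU _ (by rw [hqp]; exact ht.2)⟩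
  set F : (Fin (p + 1) → ℝ) → ℝ := fun t => f (param x₀ b t) with hF
  have hFc : ContinuousOn F T := hf.comp hparc.continuousOn hTU
  have hcone' : ∀ (ε : ℝ) t, 0 < ε → ε ≤ 1 → q t ≤ r → (ε • t ∈ S ↔ t ∈ S) := fun ε t h0 h1 h2 => by
    simp only [hS, mem_ofPred_eq, hpar, map_smul]
    exact hcone _ h2 ε h0 h1
  have hstar : ∀ t ∈ T, ∀ ε : ℝ, 0 < ε → ε ≤ 1 → ε • t ∈ T := fun t ht ε h0 h1 => by
    refine ⟨(hcone' ε t h0 h1 ht.2).2 ht.1, ?_⟩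
    rw [hqs]
    exact (mul_le_of_le_one_left (hq0 t) (pow_le_one₀ h0.le h1)).trans ht.2
  have hχq : Continuous fun t => χ (q t) := hχ.comp hqc
  set c : ℝ := p.factorial * (Matrix.of fun i j => b i ⬝ᵥ b j).det with hc
  have hcpos : 0 < c := mul_pos (by exact_mod_cast p.factorial_pos) (det_gram_pos hb)
  have hFi : IntegrableOn (fun t => F t * χ (q t)) T :=
    (hFc.mul hχq.continuousOn).integrableOn_compact hTc
  have hF0i : IntegrableOn (fun t => F 0 * χ (q t)) T :=
    (continuousOn_const.mul hχq.continuousOn).integrableOn_compact hTc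
  have hdiff : (∫ t in T, F t * χ (q t)) - (∫ t in T, F 0 * χ (q t)) =
      ∫ t in T, (F t - F 0) * χ (q t) := by
    rw [← integral_sub hFi hF0i]
    congr 1
    ext t
    ring
  have hF0 : F 0 = f x₀ := by simp [hF, hpar]
  have hle : ∀ t ∈ S, q t ≤ r → (F t - F 0) * χ (q t) ≤ 0 := fun t ht htq => by
    refine mul_nonpos_of_nonpos_of_nonneg (sub_nonpos.2 ?_) (hχ0 _ (hq0 t))
    rw [hF0]
    exact hmax _ ht (by rw [hqp]; exact htq)
  -- The contribution depends on `Φ` only through its Laplacian, hence only on `ε`.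
  refine ⟨fun ε => c * ((∫ t in T, F t * χ (q t)) - ∫ t in T, F (ε • t) * χ (q t)),
    c * ((∫ t in T, F t * χ (q t)) - ∫ t in T, F 0 * χ (q t)), ?_, ?_, ?_, ?_⟩
  · intro ε hε hε1 Φ hΦ hΦeq
    have hε2 : 0 < ε ^ 2 := by positivity
    rw [hI]
    have h1 : ∀ t, (-1 : ℝ) ^ ((p + 1) * (p + 1 - 1) / 2) * ((fun x => f x •
          dPrime (dDoublePrime fun x => radial Φ x₀ x • gramForm n p) x) (param x₀ b t)) b b =
        c * (F t * χ (q t) - F t * ((ε ^ (p + 1))⁻¹ * χ (q t / ε ^ 2))) := fun t => by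
      have e := ddc_radial_smul_gramForm_apply hΦ x₀ b t
      have e' := hΦeq (q t) (hq0 t)
      have e'' : (∑ i, t i • b i) = B t := rfl
      rw [e''] at e
      change _ = c * (4 * q t * deriv (deriv Φ) (q t) + 2 * ((p + 1 : ℕ) : ℝ) * deriv Φ (q t)) at e
      rw [e'] at e
      simp only [ContinuousAlternatingMap.smul_apply, smul_eq_mul]
      linear_combination F t * e
    simp only [h1]
    have hsub : T ⊆ {t | param x₀ b t ∈ σ ∩ U} := hTU
    have hmeas : MeasurableSet {t | param x₀ b t ∈ σ ∩ U} :=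
      hparc.measurable (hσ.isClosed.measurableSet.inter hU.measurableSet)
    -- Outside `T` both `χ` terms vanish: since `ε ≤ 1`, `q t ≥ r` implies `q t / ε ^ 2 ≥ r`.
    rw [setIntegral_eq_of_subset_of_forall_sdiff_eq_zero (s := T) hmeas hsub]
    · rw [integral_const_mul, ← setIntegral_comp_smul_eq (χ := χ) (X := fun t => χ (q t)) hε hε1 hq0
        (hqs ε) (fun _ => rfl) hχr hTc.measurableSet (fun t => hcone' ε t hε hε1), integral_sub hFi]
      refine (ContinuousOn.mul hFc (Continuous.continuousOn ?_)).integrableOn_compact hTc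
      exact continuous_const.mul (hχ.comp (hqc.div_const _))
    · rintro t ⟨ht, htT⟩
      have hqt : r ≤ q t := le_of_lt (not_le.1 fun h => htT ⟨ht.1, h⟩)
      have hqt' : r ≤ q t / ε ^ 2 := by
        rw [le_div_iff₀ hε2]
        exact (mul_le_of_le_one_right hr.le (pow_le_one₀ hε.le hε1)).trans hqt
      rw [hχr _ hqt, hχr _ hqt']
      ring
  · exact Tendsto.const_mul c
      ((tendsto_setIntegral_comp_smul hTc hT0 hstar hFc hχq.continuousOn).const_sub _)
  · rw [hdiff]
    exact mul_nonpos_of_nonneg_of_nonpos hcpos.le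
      (setIntegral_nonpos hTc.measurableSet fun t ht => hle t ht.1 ht.2)
  · intro hJ x hx hxr hxχ
    rw [hdiff] at hJ
    have hz := (mul_eq_zero.1 hJ).resolve_left hcpos.ne'
    obtain ⟨t, rfl⟩ : ∃ t, param x₀ b t = x := by
      have hxm : x -ᵥ x₀ ∈ Submodule.span ℝ (Set.range b) := hbs ▸ vsub_mem_vectorSpan ℝ hx hx₀
      obtain ⟨t, ht⟩ := (Submodule.mem_span_range_iff_exists_fun ℝ).1 hxm
      exact ⟨t, by rw [param, ht, vsub_eq_sub, add_sub_cancel]⟩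
    rw [hqp] at hxr hxχ
    have h := eq_zero_of_setIntegral_eq_zero hSconv hSint hqc hTc
      ((hFc.sub continuousOn_const).mul hχq.continuousOn) hle hz t hx hxr
    rw [← hF0]
    exact sub_eq_zero.1 ((mul_eq_zero.1 h).resolve_right hxχ)

/-! ### The maximum principle -/

/-- Near a point of `U`, all cells of a complex contain that point, and are cones. -/
theorem PolyhedralComplex.LocallyFiniteIn.exists_radius {n : ℕ} {U : Set (Fin n → ℝ)}
    {K : PolyhedralComplex n} (hK : K.LocallyFiniteIn U) {x₀ : Fin n → ℝ} (hx₀ : x₀ ∈ U) :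
    {σ ∈ K.cells | x₀ ∈ σ}.Finite ∧ ∃ r > 0, ∀ y : Fin n → ℝ, ‖y‖ < r → ∀ σ ∈ K.cells,
      (x₀ + y ∈ σ → x₀ ∈ σ) ∧
      (x₀ ∈ σ → ∀ ε : ℝ, 0 < ε → ε ≤ 1 → (x₀ + ε • y ∈ σ ↔ x₀ + y ∈ σ)) := by
  obtain ⟨V, hV, hfin⟩ := hK x₀ hx₀
  have hfin' : {σ ∈ K.cells | x₀ ∈ σ}.Finite :=
    hfin.subset fun σ hσ => ⟨hσ.1, x₀, hσ.2, mem_of_mem_nhds hV⟩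
  refine ⟨hfin', ?_⟩
  have h1 : ∀ᶠ x in 𝓝 x₀, ∀ σ ∈ K.cells, x ∈ σ → x₀ ∈ σ := by
    have : ∀ᶠ x in 𝓝 x₀, ∀ σ ∈ {σ ∈ K.cells | (σ ∩ V).Nonempty}, x ∈ σ → x₀ ∈ σ := by
      refine (eventually_all_finite hfin).2 fun σ hσ => ?_
      by_cases h : x₀ ∈ σ
      · exact Eventually.of_forall fun _ _ => h
      · filter_upwards [(K.isPolyhedron σ hσ.1).isClosed.isOpen_compl.mem_nhds h] with x hx hx'
        exact absurd hx' hx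
    filter_upwards [this, hV] with x hx hxV σ hσ hxσ using hx σ ⟨hσ, x, hxσ, hxV⟩ hxσ
  obtain ⟨r₁, hr₁, H₁⟩ := Metric.eventually_nhds_iff.1 h1
  have h2 : ∀ σ ∈ {σ ∈ K.cells | x₀ ∈ σ}, ∀ᶠ y : Fin n → ℝ in 𝓝 0, ∀ ε : ℝ, 0 < ε → ε ≤ 1 →
      (x₀ + ε • y ∈ σ ↔ x₀ + y ∈ σ) := fun σ hσ => by
    obtain ⟨r, hr, H⟩ := (K.isPolyhedron σ hσ.1).eventually_add_smul_mem_iff hσ.2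
    exact Metric.eventually_nhds_iff.2 ⟨r, hr, fun y hy => H y (by simpa using hy)⟩
  obtain ⟨r₂, hr₂, H₂⟩ := Metric.eventually_nhds_iff.1 ((eventually_all_finite hfin').2 h2)
  refine ⟨min r₁ r₂, lt_min hr₁ hr₂, fun y hy σ hσ =>
    ⟨fun hyσ => H₁ (y := x₀ + y) ?_ σ hσ hyσ, fun hx => H₂ (y := y) ?_ σ ⟨hσ, hx⟩⟩⟩
  · simpa using hy.trans_le (min_le_left _ _)
  · simpa using hy.trans_le (min_le_right _ _)

theorem ddc_smul_eq_zero {n p q : ℕ}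
    (κ : (Fin n → ℝ) [⋀^Fin p]→L[ℝ] ((Fin n → ℝ) [⋀^Fin q]→L[ℝ] ℝ))
    {φ : (Fin n → ℝ) → ℝ} (hφ : ContDiff ℝ ∞ φ) {x : Fin n → ℝ} (hx : φ =ᶠ[𝓝 x] 0) :
    dPrime (dDoublePrime (fun x => φ x • κ)) x = 0 := by
  ext v w
  have h : fderiv ℝ (fderiv ℝ φ) x = 0 := by
    rw [hx.fderiv.fderiv_eq]
    simp
  rw [ddc_smul_apply κ hφ, h]
  simp

/-- Vanishing below `a > 0` avoids the singularity of the density at `0`; vanishing from `b < r` on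
keeps the test form inside the ball where the cells are cones. -/
theorem exists_bump {s r : ℝ} (hs : 0 < s) (hsr : s < r) :
    ∃ (k : ℝ → ℝ) (a : ℝ), ContDiff ℝ ∞ k ∧ (∀ t, 0 ≤ k t) ∧ 0 < a ∧ (∀ t ≤ a, k t = 0) ∧
      (∃ b < r, ∀ t, b ≤ t → k t = 0) ∧ k s = 1 := by
  have hδ : 0 < min s (r - s) / 2 := by
    have := lt_min hs (sub_pos.2 hsr)
    positivity
  set δ := min s (r - s) / 2 with hδd
  have h1 : min s (r - s) ≤ s := min_le_left _ _
  have h2 : min s (r - s) ≤ r - s := min_le_right _ _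
  let k : ContDiffBump s := ⟨δ / 2, δ, by positivity, by linarith⟩
  refine ⟨k, s - δ, k.contDiff, fun t => k.nonneg, by linarith, fun t ht => ?_,
    ⟨s + δ, by linarith, fun t ht => ?_⟩, ?_⟩
  · refine k.zero_of_le_dist ?_
    rw [Real.dist_eq, abs_sub_comm]
    exact le_trans (by linarith) (le_abs_self _)
  · refine k.zero_of_le_dist ?_
    rw [Real.dist_eq]
    exact le_trans (by linarith) (le_abs_self _)
  · exact k.one_of_mem_closedBall (Metric.mem_closedBall_self (by positivity))

theorem contDiff_smul_const {E F : Type*} [NormedAddCommGroup E] [NormedSpace ℝ E]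
    [NormedAddCommGroup F] [NormedSpace ℝ F] {φ : E → ℝ} (hφ : ContDiff ℝ ∞ φ) (c : F) :
    ContDiff ℝ ∞ fun x => φ x • c :=
  hφ.smul contDiff_const

theorem isTestForm_radial {n p : ℕ} {U : Set (Fin n → ℝ)} {x₀ : Fin n → ℝ}
    {r : ℝ} (hrU : ∀ x, (x - x₀) ⬝ᵥ (x - x₀) ≤ r → x ∈ U) {Φ : ℝ → ℝ} (hΦ : ContDiff ℝ ∞ Φ)
    (hΦr : ∀ s, r ≤ s → Φ s = 0) :
    IsTestForm U (fun x => radial Φ x₀ x • gramForm n p) := by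
  have hK := isCompact_dotProduct_sub_le x₀ r
  have hsupp : Function.support (fun x => radial Φ x₀ x • gramForm n p) ⊆
      {x | (x - x₀) ⬝ᵥ (x - x₀) ≤ r} := fun x hx => by
    by_contra h
    refine hx ?_
    simp only [radial, hΦr _ (not_le.1 h).le]
    ext v w
    simp
  refine ⟨?_, HasCompactSupport.of_support_subset_isCompact hK hsupp,
    (closure_minimal hsupp hK.isClosed).trans hrU⟩
  exact contDiff_smul_const
    (F := (Fin n → ℝ) [⋀^Fin p]→L[ℝ] ((Fin n → ℝ) [⋀^Fin p]→L[ℝ] ℝ)) (contDiff_radial hΦ x₀) _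

theorem TropicalVariety.eventually_eq_of_succ {n p : ℕ} {U : Set (Fin n → ℝ)} (hU : IsOpen U)
    (C : TropicalVariety U (p + 1)) {f : (Fin n → ℝ) → ℝ} (hf : ContinuousOn f C.support)
    (hpsh : C.IsWeaklyPsh f) {x₀ : Fin n → ℝ} (hx₀ : x₀ ∈ C.support)
    (hmax : IsLocalMaxOn f C.support x₀) : ∀ᶠ x in 𝓝[C.support] x₀, f x = f x₀ := by
  have hx₀U : x₀ ∈ U := hx₀.2
  obtain ⟨hfin, r₁, hr₁, H⟩ := C.locallyFinite.exists_radius hx₀U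
  obtain ⟨r₂, hr₂, HU⟩ := Metric.isOpen_iff.1 hU x₀ hx₀U
  obtain ⟨r₃, hr₃, Hmax⟩ := Metric.eventually_nhds_iff.1 (eventually_nhdsWithin_iff.1 hmax)
  -- The closed Euclidean ball of radius `R` lies in `U`, in the region where `x₀` is maximal, and
  -- in the conical neighbourhood.
  obtain ⟨R, hR, hR1, hR2, hR3⟩ : ∃ R > 0, R < r₁ ∧ R < r₂ ∧ R < r₃ := by
    obtain ⟨R, hR, hR'⟩ := exists_between (lt_min hr₁ (lt_min hr₂ hr₃))
    simp only [lt_min_iff] at hR'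
    exact ⟨R, hR, hR'⟩
  set r := R ^ 2 with hrd
  have hr : 0 < r := by positivity
  have hnorm : ∀ y : Fin n → ℝ, y ⬝ᵥ y ≤ r → ‖y‖ ≤ R := fun y hy =>
    le_of_sq_le_sq ((norm_sq_le_dotProduct y).trans hy) hR.le
  have hrU : ∀ x, (x - x₀) ⬝ᵥ (x - x₀) ≤ r → x ∈ U := fun x hx => HU (by
    rw [mem_ball_iff_norm]
    exact (hnorm _ hx).trans_lt hR2)
  have hcell : ∀ σ ∈ C.cells, σ ∩ U ⊆ C.support := fun σ hσ x hx =>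
    ⟨mem_biUnion hσ hx.1, hx.2⟩
  have hmax' : ∀ σ ∈ C.cells, ∀ x ∈ σ, (x - x₀) ⬝ᵥ (x - x₀) ≤ r → f x ≤ f x₀ :=
    fun σ hσ x hx hxr => Hmax (by
      rw [dist_eq_norm]
      exact (hnorm _ hxr).trans_lt hR3) (hcell σ hσ ⟨hx, hrU x hxr⟩)
  have hnear : ∀ᶠ x in 𝓝 x₀, (x - x₀) ⬝ᵥ (x - x₀) < r := by
    have := (contDiff_dotProduct_sub x₀).continuous.tendsto x₀
    simp only [sub_self, dotProduct_zero] at this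
    exact this.eventually (gt_mem_nhds hr)
  filter_upwards [nhdsWithin_le_nhds hnear, self_mem_nhdsWithin] with x hxr hx
  rcases eq_or_ne x x₀ with rfl | hne
  · rfl
  have hs : 0 < (x - x₀) ⬝ᵥ (x - x₀) := by
    have h1 := norm_sq_le_dotProduct (x - x₀)
    have h2 : 0 < ‖x - x₀‖ := norm_pos_iff.2 (sub_ne_zero.2 hne)
    exact lt_of_lt_of_le (by positivity) h1
  -- The bump is centred at the squared distance of `x`, so that `χ` is positive at `x`.
  obtain ⟨k, a, hk, hk0, ha, hka, ⟨b, hbr, hkb⟩, hks⟩ := exists_bump hs hxr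
  set χ := radialDensity (p + 1) k with hχ
  have hχr : ∀ s, r ≤ s → χ s = 0 := fun s hs => by
    simp [hχ, radialDensity, hkb s (hbr.le.trans hs)]
  set faces := {σ ∈ C.toPolyhedralComplex.facesOfDim U (p + 1) | x₀ ∈ σ} with hfaces
  have hffin : faces.Finite := hfin.subset fun σ hσ => ⟨hσ.1.1, hσ.2⟩
  have hex : ∀ σ ∈ faces, _ := fun σ hσ =>
    exists_tendsto_faceIntegral hU (C.isPolyhedron σ hσ.1.1) hσ.2 hσ.1.2.2 hr hrU
      (fun y hy => (H y ((hnorm y hy).trans_lt hR1) σ hσ.1.1).2 hσ.2)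
      (hf.mono (hcell σ hσ.1.1)) (hmax' σ hσ.1.1)
      (continuous_radialDensity (p + 1) hk.continuous ha hka)
      (fun s => radialDensity_nonneg (p + 1) hk0) hχr
  choose! J J₀ hJ hlim hJ0 hconst using hex
  have hsum : ∀ ε : ℝ, 0 < ε → ε ≤ 1 → 0 ≤ ∑ σ ∈ hffin.toFinset, C.weight σ * J σ ε := by
    intro ε hε hε1
    obtain ⟨Φ, hΦ, hΦ0, hΦb, hΦeq⟩ := exists_radialProfile (p + 1) hk hk0 ha hka hkb hε hε1
    have hpos := hpsh (fun x => radial Φ x₀ x • gramForm n p)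
      (isTestForm_radial hrU hΦ fun s hs => hΦb s (hbr.le.trans hs))
      (fun σ _ x _ => isPositiveAt_smul_gramForm _ σ (hΦ0 _))
    -- A cell missing `x₀` stays outside the ball of squared radius `r`, where the test form
    -- vanishes. Thus only finitely many cells contribute.
    have hzero : ∀ σ ∈ C.toPolyhedralComplex.facesOfDim U (p + 1), x₀ ∉ σ →
        faceIntegral U σ (fun x => f x •
          dPrime (dDoublePrime fun x => radial Φ x₀ x • gramForm n p) x) = 0 := by
      intro σ hσ hxσ
      rw [faceIntegral]
      split_ifs with h
      · refine setIntegral_eq_zero_of_forall_eq_zero fun t ht => ?_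
        set z := param h.choose.1 h.choose.2 t
        have hz : r < (z - x₀) ⬝ᵥ (z - x₀) := not_le.1 fun hz =>
          hxσ ((H (z - x₀) ((hnorm _ hz).trans_lt hR1) σ hσ.1).1 (by
            rw [add_sub_cancel]
            exact ht.1))
        have hev : radial Φ x₀ =ᶠ[𝓝 z] 0 := by
          filter_upwards [(isOpen_lt continuous_const
            (contDiff_dotProduct_sub x₀).continuous).mem_nhds hz] with y hy
          exact hΦb _ (hbr.trans hy).le
        rw [ddc_smul_eq_zero _ (contDiff_radial hΦ x₀) hev]
        simp
      · rfl
    have heq : ddcCurrent (C.currentOf f) (fun x => radial Φ x₀ x • gramForm n p) =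
        ∑ σ ∈ hffin.toFinset, C.weight σ * J σ ε := by
      rw [ddcCurrent, TropicalVariety.currentOf, TropicalVariety.integral,
        finsum_mem_eq_sum_of_inter_support_eq (t := hffin.toFinset)]
      · refine Finset.sum_congr rfl fun σ hσ => ?_
        rw [hJ σ (hffin.mem_toFinset.1 hσ) ε hε hε1 Φ hΦ hΦeq]
      · ext σ
        simp only [mem_inter_iff, Finite.coe_toFinset, Function.mem_support, hfaces,
          mem_ofPred_eq]
        refine ⟨fun h => ⟨⟨h.1, ?_⟩, h.2⟩, fun h => ⟨h.1.1, h.2⟩⟩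
        by_contra hxσ
        exact h.2 (by rw [hzero σ h.1 hxσ, mul_zero])
    rw [heq] at hpos
    exact hpos
  have hlim' : Tendsto (fun ε => ∑ σ ∈ hffin.toFinset, C.weight σ * J σ ε) (𝓝[>] 0)
      (𝓝 (∑ σ ∈ hffin.toFinset, C.weight σ * J₀ σ)) :=
    tendsto_finsetSum _ fun σ hσ => (hlim σ (hffin.mem_toFinset.1 hσ)).const_mul _
  have hge : 0 ≤ ∑ σ ∈ hffin.toFinset, C.weight σ * J₀ σ := by
    refine ge_of_tendsto hlim' ?_
    filter_upwards [self_mem_nhdsWithin, nhdsWithin_le_nhds (Iio_mem_nhds one_pos)] with ε h1 h2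
    exact hsum ε h1 (le_of_lt h2)
  have hnonpos : ∀ σ ∈ hffin.toFinset, C.weight σ * J₀ σ ≤ 0 := fun σ hσ =>
    mul_nonpos_of_nonneg_of_nonpos (C.weight_pos σ (hffin.mem_toFinset.1 hσ).1).le
      (hJ0 σ (hffin.mem_toFinset.1 hσ))
  -- A nonnegative sum of nonpositive terms: each one is zero.
  have hall := (Finset.sum_eq_zero_iff_of_nonpos hnonpos).1
    (le_antisymm (Finset.sum_nonpos hnonpos) hge)
  obtain ⟨hxc, hxU⟩ := hx
  obtain ⟨σ, hσ, hxσ⟩ := mem_iUnion₂.1 hxc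
  -- Purity puts `x` in a top-dimensional cell, which contains `x₀` because `x` is close to it.
  obtain ⟨σ', hσ', hsub⟩ := C.pure_dim σ hσ ⟨x, hxσ, hxU⟩
  have hx₀σ : x₀ ∈ σ' := (H (x - x₀) ((hnorm _ hxr.le).trans_lt hR1) σ' hσ'.1).1 (by
    rw [add_sub_cancel]
    exact hsub hxσ)
  have hmem : σ' ∈ faces := ⟨hσ', hx₀σ⟩
  refine hconst σ' hmem ((mul_eq_zero.1 (hall σ' (hffin.mem_toFinset.2 hmem))).resolve_left
    (C.weight_pos σ' hσ').ne') x (hsub hxσ) hxr ?_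
  rw [radialDensity, hks]
  have := Real.rpow_pos_of_pos hs (-(((p + 1 : ℕ) : ℝ) / 2))
  positivity

/-- A nearby point shares a zero-dimensional cell with `x₀`, and such a cell is a single point. -/
theorem TropicalVariety.eventually_eq_of_zero {n : ℕ} {U : Set (Fin n → ℝ)}
    (C : TropicalVariety U 0) {x₀ : Fin n → ℝ} (hx₀ : x₀ ∈ C.support) :
    ∀ᶠ x in 𝓝[C.support] x₀, x = x₀ := by
  obtain ⟨-, r, hr, H⟩ := C.locallyFinite.exists_radius hx₀.2
  filter_upwards [nhdsWithin_le_nhds (Metric.ball_mem_nhds x₀ hr),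
    self_mem_nhdsWithin] with x hxr hx
  obtain ⟨hxc, hxU⟩ := hx
  obtain ⟨σ, hσ, hxσ⟩ := mem_iUnion₂.1 hxc
  obtain ⟨σ', hσ', hsub⟩ := C.pure_dim σ hσ ⟨x, hxσ, hxU⟩
  have hx₀σ : x₀ ∈ σ' := (H (x - x₀) (by rwa [mem_ball_iff_norm] at hxr) σ' hσ'.1).1 (by
    rw [add_sub_cancel]
    exact hsub hxσ)
  have h0 : vectorSpan ℝ σ' = ⊥ := Submodule.finrank_eq_zero.1 hσ'.2.2
  have h := vsub_mem_vectorSpan ℝ (hsub hxσ) hx₀σ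
  rw [h0, Submodule.mem_bot] at h
  exact sub_eq_zero.1 h

end Tropical

end

theorem mainTheorem9 {n d : ℕ} (U : Set (Fin n → ℝ)) (hU : IsOpen U)
    (C : Tropical.TropicalVariety U d) (f : (Fin n → ℝ) → ℝ)
    (hf : C.IsPiecewiseSmooth f) (hpsh : C.IsWeaklyPsh f)
    (x₀ : Fin n → ℝ) (hx₀ : x₀ ∈ C.support) (hmax : IsLocalMaxOn f C.support x₀) :
    ∀ᶠ x in 𝓝[C.support] x₀, f x = f x₀ := by
  cases d with
  | zero => exact (C.eventually_eq_of_zero hx₀).mono fun x hx => by rw [hx]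
  | succ p => exact C.eventually_eq_of_succ hU hf.1 hpsh hx₀ hmax
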